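/- **Setting.** Let $(\Sigma,\mathcal T)$ be an ideally triangulated compact surface with boundary: a finite disjoint union of topological hexagons, each with three pairwise non-adjacent red sides and three black sides, in which the red sides are identified in pairs by homeomorphisms ($\Sigma$ need not be orientable or connected). The hexagons form the set $F$ of faces, the images of the red sides form the set $E$ of edges, and $B=\{1,\dots,n\}$ is the set of boundary components of $\Sigma$, each of which is a union of black sides glued at their endpoints. An edge that joins the boundary components $i$ and $j$ (possibly $i=j$) is written $ij$, although several edges may join the same components. A discrete hyperbolic metric is a function $l:E\to(0,\infty)$. It turns every face into the convex hyperbolic right-angled hexagon, unique up to isometry, whose red sides have the lengths given by $l$. The generalized combinatorial curvature $K_i$ of $l$ at $i\in B$ is the length of the boundary component $i$, that is, the sum of the lengths of the black sides of which it consists. Fix a discrete hyperbolic metric $\tilde l$. A vector $w\in\mathbb R^n$ is admissible, $w\in\mathcal W=\mathcal W(\tilde l)$, if there is a discrete hyperbolic metric $l=w*\tilde l$ with $$\cosh\frac{l_{ij}}2=e^{w_i+w_j}\cosh\frac{\tilde l_{ij}}2\qquad\text{for every edge } ij\in E .$$ Write $K(w)\in\mathbb R^n_{>0}$ for the generalized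 combinatorial curvature of $w*\tilde l$, and $\Delta(w)=\bigl(\partial K_i/\partial w_j\bigr)_{n\times n}$ for its Jacobian matrix, the discrete Laplace operator. **Theorem.** Let $(\Sigma,\mathcal T)$ be an ideally triangulated compact surface with boundary, let $\tilde l\in\mathbb R^E_{>0}$ be a discrete hyperbolic metric on it, and let $\bar K\in\mathbb R^n_{>0}$. Then $K$ is differentiable on $\mathcal W$, and there is a unique $\bar w\in\mathcal W$ with $K(\bar w)=\bar K$. For every $w_0\in\mathcal W$, the combinatorial Calabi flow $$\frac{dw}{dt}=\Delta(w)\,\bigl(\bar K-K(w)\bigr),\qquad w(0)=w_0,$$ has a solution $w:[0,\infty)\to\mathcal W$ for all time. It is the only one: every solution in $\mathcal W$ on an interval $[0,b)$ is the restriction of $w$ to $[0,b)$. It converges exponentially fast to $\bar w$: there are constants $C,c>0$ such that $$|w_i(t)-\bar w_i|\le C e^{-ct}\qquad\text{for all } t\ge 0 \text{ and all } i\in B.$$ -/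

import Mathlib

open scoped Matrix

/-! ### Hyperbolic right-angled hexagons, in the hyperboloid model of the hyperbolic plane -/

/-- The Lorentz form on `ℝ³`. -/
def lorentz (x y : Fin 3 → ℝ) : ℝ := -(x 0 * y 0) + x 1 * y 1 + x 2 * y 2

/-- The hyperbolic plane: the upper sheet of the hyperboloid `⟨x, x⟩ = -1`. -/
def hyperbolicPlane : Set (Fin 3 → ℝ) := {x | lorentz x x = -1 ∧ 0 < x 0}

/-- The hyperbolic distance. -/
noncomputable def hypDist (x y : Fin 3 → ℝ) : ℝ := Real.arcosh (-lorentz x y)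

/-- The tangent vector at the point `x` of the hyperbolic plane that points along the geodesic
from `x` to `y` (the Lorentz-orthogonal projection of `y` to the tangent space at `x`). -/
def tangentTowards (x y : Fin 3 → ℝ) : Fin 3 → ℝ := y + lorentz x y • x

/-- A convex right-angled hexagon in the hyperbolic plane, with its vertices listed
counterclockwise. -/
structure RightAngledHexagon where
  /-- the vertices, in cyclic order -/
  vertex : Fin 6 → Fin 3 → ℝ
  vertex_mem : ∀ i, vertex i ∈ hyperbolicPlane
  /-- Every vertex that is not on a side lies strictly to the left of the geodesic line through
  that side. -/
  convex : ∀ i j, j ≠ i → j ≠ i + 1 →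
    0 < Matrix.det (Matrix.of ![vertex i, vertex (i + 1), vertex j])
  /-- The two sides that meet at a vertex are orthogonal there. -/
  right_angle : ∀ i, lorentz (tangentTowards (vertex i) (vertex (i - 1)))
    (tangentTowards (vertex i) (vertex (i + 1))) = 0

/-- The length of the side from vertex `i` to vertex `i + 1`. -/
noncomputable def RightAngledHexagon.sideLength (P : RightAngledHexagon) (i : Fin 6) : ℝ :=
  hypDist (P.vertex i) (P.vertex (i + 1))

/-- In the hyperbolic right-angled hexagon whose three pairwise non-adjacent red sides have
lengths `a`, `b`, `c > 0` (it is unique up to isometry): the length of the black side opposite to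
the red side of length `a`. -/
noncomputable def blackLength (a b c : ℝ) : ℝ :=
  Classical.epsilon fun θ : ℝ => ∃ P : RightAngledHexagon,
    P.sideLength 0 = a ∧ P.sideLength 2 = b ∧ P.sideLength 4 = c ∧ P.sideLength 3 = θ

/-! ### Ideally triangulated surfaces with boundary -/

/-- An ideally triangulated compact surface with boundary, with set of faces `F`, given by its
gluing pattern. Each face is a hexagon with three red sides `(f, 0)`, `(f, 1)`, `(f, 2)` and three
black sides `(f, 0)`, `(f, 1)`, `(f, 2)`, where the red side `(f, k)` is opposite to the black side
`(f, k)`, so that it runs from the black side `(f, k + 1)` to the black side `(f, k + 2)`.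
The red sides are identified in pairs. An identification `r ↔ glue r` is up to isotopy one of two
homeomorphisms; `same r` tells which one: if it is true, the initial endpoint of `r` goes to the
initial endpoint of `glue r`, otherwise to its terminal endpoint. (If `same` is identically false,
the gluing respects the orientations of the hexagons; the surface need not be orientable.) -/
structure IdealTriangulation (F : Type*) where
  /-- the red side to which a red side is glued -/
  glue : F × Fin 3 → F × Fin 3
  glue_glue : ∀ r, glue (glue r) = r
  glue_ne : ∀ r, glue r ≠ r
  /-- how the endpoints are matched -/
  same : F × Fin 3 → Bool
  same_glue : ∀ r, same (glue r) = same r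

namespace IdealTriangulation

variable {F : Type*}

/-- The black side on which the red side `r` begins. -/
def initial (r : F × Fin 3) : F × Fin 3 := (r.1, r.2 + 1)

/-- The black side on which the red side `r` ends. -/
def terminal (r : F × Fin 3) : F × Fin 3 := (r.1, r.2 + 2)

/-- Two black sides are glued together at an endpoint. -/
inductive Meets (T : IdealTriangulation F) : F × Fin 3 → F × Fin 3 → Prop
  | initial (r : F × Fin 3) : Meets T (IdealTriangulation.initial r)
      (if T.same r then IdealTriangulation.initial (T.glue r)
        else IdealTriangulation.terminal (T.glue r))
  | terminal (r : F × Fin 3) : Meets T (IdealTriangulation.terminal r)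
      (if T.same r then IdealTriangulation.terminal (T.glue r)
        else IdealTriangulation.initial (T.glue r))

/-- The set `B` of boundary components: the classes of black sides under the equivalence relation
generated by being glued together at an endpoint. -/
def Bdry (T : IdealTriangulation F) : Type _ := Quot T.Meets

/-- The set `E` of edges: the red sides up to the identification. -/
def Edge (T : IdealTriangulation F) : Type _ := Quot fun r s : F × Fin 3 => s = T.glue r

/-- The boundary component that contains a black side. -/
def comp (T : IdealTriangulation F) (c : F × Fin 3) : T.Bdry := Quot.mk _ c

/-- The edge that is the image of a red side. -/
def edge (T : IdealTriangulation F) (r : F × Fin 3) : T.Edge := Quot.mk _ r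

noncomputable instance [Fintype F] (T : IdealTriangulation F) : Fintype T.Bdry :=
  @Fintype.ofFinite _ (inferInstanceAs (Finite (Quot T.Meets)))

noncomputable instance (T : IdealTriangulation F) : DecidableEq T.Bdry := Classical.decEq _

/-- `w_i + w_j`, where `i` and `j` (possibly equal) are the boundary components at the two ends of
an edge. -/
def endSum (T : IdealTriangulation F) (w : T.Bdry → ℝ) : T.Edge → ℝ :=
  Quot.lift (fun r => w (T.comp (initial r)) + w (T.comp (terminal r))) (by
    rintro r s rfl
    have h1 := Quot.sound (Meets.initial (T := T) r)
    have h2 := Quot.sound (Meets.terminal (T := T) r)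
    simp only [comp]
    rw [h1, h2]
    cases T.same r
    · simp [add_comm]
    · simp)

/-- A discrete hyperbolic metric: a positive length for every edge. -/
def IsDiscreteMetric (T : IdealTriangulation F) (l : T.Edge → ℝ) : Prop := ∀ e, 0 < l e

/-- `l` is the vertex scaling of `l'` by the factor `w`. -/
def IsVertexScaling (T : IdealTriangulation F) (l' : T.Edge → ℝ) (w : T.Bdry → ℝ)
    (l : T.Edge → ℝ) : Prop :=
  ∀ e, Real.cosh (l e / 2) = Real.exp (T.endSum w e) * Real.cosh (l' e / 2)

/-- The space of admissible discrete conformal factors of `l'`. -/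
def admissible (T : IdealTriangulation F) (l' : T.Edge → ℝ) : Set (T.Bdry → ℝ) :=
  {w | ∃ l, T.IsDiscreteMetric l ∧ T.IsVertexScaling l' w l}

/-- The discrete hyperbolic metric `w * l'` (for admissible `w`): the positive solution `l` of
`cosh (l e / 2) = exp (w_i + w_j) cosh (l' e / 2)`. -/
noncomputable def scaled (T : IdealTriangulation F) (l' : T.Edge → ℝ) (w : T.Bdry → ℝ) :
    T.Edge → ℝ :=
  fun e => 2 * Real.arcosh (Real.exp (T.endSum w e) * Real.cosh (l' e / 2))

/-- The length of the black side `c` in its face, realized as the hyperbolic right-angled hexagon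
whose red sides have the lengths given by `l`. -/
noncomputable def arcLength (T : IdealTriangulation F) (l : T.Edge → ℝ) (c : F × Fin 3) : ℝ :=
  blackLength (l (T.edge c)) (l (T.edge (c.1, c.2 + 1))) (l (T.edge (c.1, c.2 + 2)))

/-- The generalized combinatorial curvature of the metric `l` at the boundary component `i`: its
length, that is, the total length of the black sides of which it consists. -/
noncomputable def curvature [Fintype F] (T : IdealTriangulation F) (l : T.Edge → ℝ)
    (i : T.Bdry) : ℝ :=
  ∑ c : F × Fin 3, if T.comp c = i then T.arcLength l c else 0

/-- The generalized combinatorial curvature of `w * l'`, as a function of `w`. -/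
noncomputable def K [Fintype F] (T : IdealTriangulation F) (l' : T.Edge → ℝ) (w : T.Bdry → ℝ) :
    T.Bdry → ℝ :=
  T.curvature (T.scaled l' w)

/-- The discrete Laplace operator at `w`: the Jacobian matrix `(∂ K_i / ∂ w_j)`. -/
noncomputable def laplacian [Fintype F] (T : IdealTriangulation F) (l' : T.Edge → ℝ)
    (w : T.Bdry → ℝ) : Matrix T.Bdry T.Bdry ℝ :=
  Matrix.of fun i j => fderiv ℝ (T.K l') w (Pi.single j 1) i

/-- `w` solves the combinatorial Calabi flow with target `Kbar` and initial value `w₀` on the time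
interval `I` (with one-sided derivatives at endpoints of `I`). -/
def IsCalabiFlow [Fintype F] (T : IdealTriangulation F) (l' : T.Edge → ℝ) (Kbar w₀ : T.Bdry → ℝ)
    (I : Set ℝ) (w : ℝ → T.Bdry → ℝ) : Prop :=
  w 0 = w₀ ∧ ∀ t ∈ I, w t ∈ T.admissible l' ∧
    ∀ i, HasDerivWithinAt (fun s => w s i) ((T.laplacian l' (w t) *ᵥ (Kbar - T.K l' (w t))) i) I t

end IdealTriangulation

/-! Everything about the flow follows from a few properties of `K`, collected in `IsCurvatureMap`:
`K` is smooth enough on an open convex set, its Jacobian is symmetric and negative definite, and it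
is proper as a map to the positive orthant.

These properties come from a single hexagon. The law of cosines `RightAngledHexagon.cosh_law` makes
a black side an explicit function of the red ones. In the variable log cosh(l/2) vertex scaling is
the addition of w_i + w_j, so admissibility is a system of affine inequalities. The Jacobian is a
sum of 3×3 forms, one for each face; they are symmetric (`blackArcDeriv_form_symm`) and equal to
minus an explicit sum of squares (`blackArcDeriv_form_eq`). Properness rests on three estimates:
bounded black sides keep the red sides from collapsing and w from going to -∞, and if w_i goes to +∞
while all lengths stay bounded, then the black sides at i shrink to 0.

Negative definiteness on a convex set makes `K` injective with open image; properness makes the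
image closed in the connected orthant, so the target is attained exactly once. Symmetry gives `Kbar
- K` a potential H, convex with minimum at `wbar`. The Calabi flow is gradient descent for the
energy |Kbar - K|², and H decreases along it too. A bound on the energy does not keep K_i away from
0, where w_i could escape to infinity, but a bound on H confines w. Together they trap the flow in a
compact subset of the admissible set, which gives existence for all time. On this subset the
Jacobian is uniformly definite, so the energy decays exponentially and dominates the squared
distance to `wbar`. -/

/-! ### Lorentz geometry and the law of cosines for right-angled hexagons. -/

theorem lorentz_comm (x y : Fin 3 → ℝ) : lorentz x y = lorentz y x := by
  simp only [lorentz]; ring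

theorem lorentz_add_left (x y z : Fin 3 → ℝ) : lorentz (x + y) z = lorentz x z + lorentz y z := by
  simp only [lorentz, Pi.add_apply]; ring

theorem lorentz_smul_left (a : ℝ) (x z : Fin 3 → ℝ) : lorentz (a • x) z = a * lorentz x z := by
  simp only [lorentz, Pi.smul_apply, smul_eq_mul]; ring

theorem lorentz_add_right (x y z : Fin 3 → ℝ) : lorentz x (y + z) = lorentz x y + lorentz x z := by
  simp only [lorentz, Pi.add_apply]; ring

theorem lorentz_smul_right (a : ℝ) (x z : Fin 3 → ℝ) : lorentz x (a • z) = a * lorentz x z := by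
  simp only [lorentz, Pi.smul_apply, smul_eq_mul]; ring

theorem one_le_neg_lorentz {x y : Fin 3 → ℝ} (hx : x ∈ hyperbolicPlane)
    (hy : y ∈ hyperbolicPlane) : 1 ≤ -lorentz x y := by
  obtain ⟨hx, hx0⟩ := hx
  obtain ⟨hy, hy0⟩ := hy
  simp only [lorentz] at *
  have h : 1 + (x 1 * y 1 + x 2 * y 2) ≤ x 0 * y 0 := by
    apply abs_le_of_sq_le_sq' _ (by positivity) |>.2
    have h1 : x 0 ^ 2 = 1 + x 1 ^ 2 + x 2 ^ 2 := by linarith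
    have h2 : y 0 ^ 2 = 1 + y 1 ^ 2 + y 2 ^ 2 := by linarith
    rw [mul_pow, h1, h2]
    nlinarith [sq_nonneg (x 1 - y 1), sq_nonneg (x 2 - y 2), sq_nonneg (x 1 * y 2 - x 2 * y 1)]
  linarith

theorem lorentz_tangentTowards {x y z : Fin 3 → ℝ} (hx : lorentz x x = -1) :
    lorentz (tangentTowards x y) (tangentTowards x z) =
      lorentz y z + lorentz x y * lorentz x z := by
  simp only [tangentTowards, lorentz_add_left, lorentz_add_right, lorentz_smul_left,
    lorentz_smul_right, hx, lorentz_comm y x]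
  ring

/-- The Lorentzian cross product. -/
def lorentzCross (x y : Fin 3 → ℝ) : Fin 3 → ℝ :=
  ![-(x 1 * y 2 - x 2 * y 1), x 2 * y 0 - x 0 * y 2, x 0 * y 1 - x 1 * y 0]

theorem lorentz_lorentzCross (x y z : Fin 3 → ℝ) :
    lorentz z (lorentzCross x y) = Matrix.det (Matrix.of ![x, y, z]) := by
  simp [lorentz, lorentzCross, Matrix.det_fin_three]
  ring

theorem lorentz_lorentzCross_self (x y : Fin 3 → ℝ) :
    lorentz (lorentzCross x y) (lorentzCross x y) =
      lorentz x y ^ 2 - lorentz x x * lorentz y y := by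
  simp [lorentz, lorentzCross]
  ring

/-- The orthogonal complement of a plane is spanned by its normal. The polynomial identity `key`
expands any z in x, y and the normal, so independence of x and y is not needed. -/
theorem lorentzCross_smul_eq_of_orthogonal {x y z : Fin 3 → ℝ} (hx : lorentz z x = 0)
    (hy : lorentz z y = 0) :
    lorentz (lorentzCross x y) (lorentzCross x y) • z =
      lorentz z (lorentzCross x y) • lorentzCross x y := by
  have key : lorentz (lorentzCross x y) (lorentzCross x y) • z =
      lorentz z (lorentzCross x y) • lorentzCross x y
        - (lorentz y y * lorentz z x - lorentz x y * lorentz z y) • x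
        - (lorentz x x * lorentz z y - lorentz x y * lorentz z x) • y := by
    funext i
    simp only [Pi.sub_apply, Pi.smul_apply, smul_eq_mul]
    fin_cases i <;> simp [lorentz, lorentzCross] <;> ring
  rw [key, hx, hy]
  simp

/-- At a right angle at `q` between `p` and `r`, the tangent vector towards `r` is proportional to
the normal of the line through `p` and `q`. -/
theorem smul_tangentTowards_eq {p q r : Fin 3 → ℝ} {s t : ℝ} (hp : lorentz p p = -1)
    (hq : lorentz q q = -1) (hr : lorentz r r = -1)
    (hpr : lorentz (tangentTowards q p) (tangentTowards q r) = 0)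
    (hdet : 0 < Matrix.det (Matrix.of ![p, q, r])) (hs : 0 < s) (ht : 0 < t)
    (hs2 : s ^ 2 = lorentz p q ^ 2 - 1) (ht2 : t ^ 2 = lorentz q r ^ 2 - 1) :
    s • tangentTowards q r = t • lorentzCross p q := by
  have hX : tangentTowards q r = r + lorentz q r • q := rfl
  rw [lorentz_tangentTowards hq] at hpr
  have h1 : lorentz (tangentTowards q r) p = 0 := by
    rw [hX, lorentz_add_left, lorentz_smul_left, lorentz_comm r p]; linarith
  have h2 : lorentz (tangentTowards q r) q = 0 := by
    rw [hX, lorentz_add_left, lorentz_smul_left, lorentz_comm r q, hq]; ring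
  have hNN : lorentz (lorentzCross p q) (lorentzCross p q) = s ^ 2 := by
    rw [lorentz_lorentzCross_self, hp, hq, hs2]; ring
  have hXX : lorentz (tangentTowards q r) (tangentTowards q r) = t ^ 2 := by
    rw [lorentz_tangentTowards hq, hr, ht2]; ring
  have h3 := lorentzCross_smul_eq_of_orthogonal h1 h2
  have hD : 0 < lorentz (tangentTowards q r) (lorentzCross p q) := by
    have : lorentz q (lorentzCross p q) = 0 := by
      simp [lorentz, lorentzCross]; ring
    rw [hX, lorentz_add_left, lorentz_smul_left, this, lorentz_lorentzCross]
    linarith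
  set D := lorentz (tangentTowards q r) (lorentzCross p q)
  rw [hNN] at h3
  have h4 : s ^ 2 * t ^ 2 = D ^ 2 := by
    have := congrArg (lorentz (tangentTowards q r)) h3
    rw [lorentz_smul_right, lorentz_smul_right, hXX] at this
    rw [this, sq]
  have h5 : D = s * t := by
    rw [← mul_pow] at h4
    exact ((pow_left_inj₀ (by positivity) hD.le two_ne_zero).1 h4).symm
  rw [h5] at h3
  have h6 : s • (s • tangentTowards q r) = s • (t • lorentzCross p q) := by
    rw [smul_smul, smul_smul, ← sq, h3]
  exact smul_right_injective _ hs.ne' h6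

/-- The mirror image of `smul_tangentTowards_eq`: exchange p and r, and replace p by -p to restore
the sign of the determinant. The point -p lies on the lower sheet, which does no harm because only
⟨p, p⟩ = -1 is used. -/
theorem smul_tangentTowards_eq' {p q r : Fin 3 → ℝ} {s t : ℝ} (hp : lorentz p p = -1)
    (hq : lorentz q q = -1) (hr : lorentz r r = -1)
    (hpr : lorentz (tangentTowards q p) (tangentTowards q r) = 0)
    (hdet : 0 < Matrix.det (Matrix.of ![p, q, r])) (hs : 0 < s) (ht : 0 < t)
    (hs2 : s ^ 2 = lorentz p q ^ 2 - 1) (ht2 : t ^ 2 = lorentz q r ^ 2 - 1) :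
    t • tangentTowards q p = s • lorentzCross q r := by
  have h := smul_tangentTowards_eq (p := r) (q := q) (r := -p) (s := t) (t := s) hr hq
    (by rw [← hp]; simp [lorentz])
    (by
      rw [lorentz_tangentTowards hq] at hpr ⊢
      simp only [lorentz, Pi.neg_apply] at hpr ⊢
      linarith)
    (by
      convert hdet using 1
      simp [Matrix.det_fin_three]
      ring) ht hs (by rw [ht2, lorentz_comm]) (by
        rw [hs2]; simp only [lorentz, Pi.neg_apply]; ring)
  have e1 : tangentTowards q (-p) = -tangentTowards q p := by
    funext i; simp [tangentTowards, lorentz]; ring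
  have e2 : lorentzCross r q = -lorentzCross q r := by
    funext i; fin_cases i <;> simp [lorentzCross] <;> ring
  rw [e1, e2, smul_neg, smul_neg, neg_inj] at h
  exact h

namespace RightAngledHexagon

variable (P : RightAngledHexagon)

theorem cosh_sideLength (i : Fin 6) :
    Real.cosh (P.sideLength i) = -lorentz (P.vertex i) (P.vertex (i + 1)) :=
  Real.cosh_arcosh (one_le_neg_lorentz (P.vertex_mem i) (P.vertex_mem (i + 1)))

theorem det_pos (i : Fin 6) :
    0 < Matrix.det (Matrix.of ![P.vertex i, P.vertex (i + 1), P.vertex (i + 2)]) :=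
  P.convex i (i + 2) (by revert i; decide) (by revert i; decide)

theorem sideLength_pos (i : Fin 6) : 0 < P.sideLength i := by
  refine Real.arcosh_pos (lt_of_le_of_ne
    (one_le_neg_lorentz (P.vertex_mem i) (P.vertex_mem (i + 1))) fun h => ?_)
  have h1 := (P.vertex_mem i).1
  have h2 := (P.vertex_mem (i + 1)).1
  have h3 : P.vertex i = P.vertex (i + 1) := by
    obtain ⟨-, h4⟩ := P.vertex_mem i
    obtain ⟨-, h5⟩ := P.vertex_mem (i + 1)
    generalize P.vertex i = x at *
    generalize P.vertex (i + 1) = y at *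
    simp only [lorentz] at h h1 h2
    -- Equality in the reversed Cauchy–Schwarz inequality: this sum of squares vanishes, so x and y
    -- are proportional with equal first coordinates. Then a determinant with two equal rows would
    -- have to be positive.
    have e : (x 0 * y 1 - x 1 * y 0) ^ 2 + (x 0 * y 2 - x 2 * y 0) ^ 2
        + (x 0 - y 0) ^ 2 = 0 := by
      have a1 : x 1 ^ 2 = x 0 ^ 2 - 1 - x 2 ^ 2 := by linarith
      have a2 : y 1 ^ 2 = y 0 ^ 2 - 1 - y 2 ^ 2 := by linarith
      have a3 : x 1 * y 1 = x 0 * y 0 - 1 - x 2 * y 2 := by linarith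
      have : (x 0 * y 1 - x 1 * y 0) ^ 2 + (x 0 * y 2 - x 2 * y 0) ^ 2 + (x 0 - y 0) ^ 2 =
        x 0 ^ 2 * y 1 ^ 2 + x 1 ^ 2 * y 0 ^ 2 - 2 * x 0 * y 0 * (x 1 * y 1)
          + (x 0 * y 2 - x 2 * y 0) ^ 2 + (x 0 - y 0) ^ 2 := by ring
      rw [this, a1, a2, a3]; ring
    have b1 : (x 0 * y 1 - x 1 * y 0) = 0 := by
      refine pow_eq_zero_iff two_ne_zero |>.1 (le_antisymm ?_ (sq_nonneg _))
      nlinarith [sq_nonneg (x 0 * y 2 - x 2 * y 0), sq_nonneg (x 0 - y 0)]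
    have b2 : (x 0 * y 2 - x 2 * y 0) = 0 := by
      refine pow_eq_zero_iff two_ne_zero |>.1 (le_antisymm ?_ (sq_nonneg _))
      nlinarith [sq_nonneg (x 0 * y 1 - x 1 * y 0), sq_nonneg (x 0 - y 0)]
    have b3 : x 0 = y 0 := by
      refine sub_eq_zero.1 (pow_eq_zero_iff two_ne_zero |>.1 (le_antisymm ?_ (sq_nonneg _)))
      nlinarith [sq_nonneg (x 0 * y 1 - x 1 * y 0), sq_nonneg (x 0 * y 2 - x 2 * y 0)]
    rw [b3] at b1 b2
    have b4 : x 1 = y 1 := mul_left_cancel₀ h5.ne' (by linarith)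
    have b5 : x 2 = y 2 := mul_left_cancel₀ h5.ne' (by linarith)
    funext k
    fin_cases k <;> assumption
  have h4 := P.det_pos i
  rw [h3] at h4
  simp [Matrix.det_fin_three] at h4
  linarith

theorem sinh_sideLength_sq (i : Fin 6) :
    Real.sinh (P.sideLength i) ^ 2 = lorentz (P.vertex i) (P.vertex (i + 1)) ^ 2 - 1 := by
  rw [Real.sinh_sq, cosh_sideLength]; ring

theorem sinh_smul_tangentTowards (i : Fin 6) :
    Real.sinh (P.sideLength i) • tangentTowards (P.vertex (i + 1)) (P.vertex (i + 2)) =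
      Real.sinh (P.sideLength (i + 1)) • lorentzCross (P.vertex i) (P.vertex (i + 1)) := by
  have h := P.right_angle (i + 1)
  rw [add_sub_cancel_right, add_assoc, show (1 + 1 : Fin 6) = 2 from rfl] at h
  have h' := P.sinh_sideLength_sq (i + 1)
  rw [add_assoc, show (1 + 1 : Fin 6) = 2 from rfl] at h'
  exact smul_tangentTowards_eq (P.vertex_mem _).1 (P.vertex_mem _).1 (P.vertex_mem _).1 h
    (P.det_pos i) (Real.sinh_pos_iff.2 (P.sideLength_pos _))
    (Real.sinh_pos_iff.2 (P.sideLength_pos _)) (P.sinh_sideLength_sq i) h'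

theorem sinh_smul_tangentTowards' (i : Fin 6) :
    Real.sinh (P.sideLength (i + 1)) • tangentTowards (P.vertex (i + 1)) (P.vertex i) =
      Real.sinh (P.sideLength i) • lorentzCross (P.vertex (i + 1)) (P.vertex (i + 2)) := by
  have h := P.right_angle (i + 1)
  rw [add_sub_cancel_right, add_assoc, show (1 + 1 : Fin 6) = 2 from rfl] at h
  have h' := P.sinh_sideLength_sq (i + 1)
  rw [add_assoc, show (1 + 1 : Fin 6) = 2 from rfl] at h'
  exact smul_tangentTowards_eq' (P.vertex_mem _).1 (P.vertex_mem _).1 (P.vertex_mem _).1 h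
    (P.det_pos i) (Real.sinh_pos_iff.2 (P.sideLength_pos _))
    (Real.sinh_pos_iff.2 (P.sideLength_pos _)) (P.sinh_sideLength_sq i) h'

/-- The common perpendicular directions at the two ends of a side agree with the normal. -/
theorem smul_tangentTowards_eq_smul_tangentTowards (i : Fin 6) :
    Real.sinh (P.sideLength (i + 2)) • tangentTowards (P.vertex (i + 1)) (P.vertex i) =
      Real.sinh (P.sideLength i) • tangentTowards (P.vertex (i + 2)) (P.vertex (i + 3)) := by
  have h1 := P.sinh_smul_tangentTowards' i
  have h2 := P.sinh_smul_tangentTowards (i + 1)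
  simp only [add_assoc, show (1 + 1 : Fin 6) = 2 from rfl, show (1 + 2 : Fin 6) = 3 from rfl] at h2
  have hs := (Real.sinh_pos_iff.2 (P.sideLength_pos (i + 1))).ne'
  refine smul_right_injective _ hs ?_
  simp only
  rw [smul_comm, h1, smul_comm (Real.sinh (P.sideLength (i + 1))) (Real.sinh (P.sideLength i)), h2,
    smul_comm]

/-- The law of cosines for right-angled hexagons. -/
theorem cosh_law : Real.cosh (P.sideLength 0) =
    Real.cosh (P.sideLength 3) * Real.sinh (P.sideLength 2) * Real.sinh (P.sideLength 4) -
      Real.cosh (P.sideLength 2) * Real.cosh (P.sideLength 4) := by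
  have h1 := P.smul_tangentTowards_eq_smul_tangentTowards 0
  have h2 := P.smul_tangentTowards_eq_smul_tangentTowards 4
  have h3 := P.smul_tangentTowards_eq_smul_tangentTowards 2
  simp only [show (4 + 2 : Fin 6) = 0 from rfl, show (4 + 1 : Fin 6) = 5 from rfl,
    show (4 + 3 : Fin 6) = 1 from rfl, show (0 + 2 : Fin 6) = 2 from rfl,
    show (0 + 1 : Fin 6) = 1 from rfl, show (0 + 3 : Fin 6) = 3 from rfl,
    show (2 + 2 : Fin 6) = 4 from rfl, show (2 + 1 : Fin 6) = 3 from rfl,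
    show (2 + 3 : Fin 6) = 5 from rfl] at h1 h2 h3
  have hc (i : Fin 6) := P.cosh_sideLength i
  have hs (i : Fin 6) := P.sinh_sideLength_sq i
  have hv (i : Fin 6) := (P.vertex_mem i).1
  have s0 := Real.sinh_pos_iff.2 (P.sideLength_pos 0)
  have s2 := Real.sinh_pos_iff.2 (P.sideLength_pos 2)
  have s4 := Real.sinh_pos_iff.2 (P.sideLength_pos 4)
  have c0 := hc 0
  have c2 := hc 2
  have c3 := hc 3
  have c4 := hc 4
  have q0 := hs 0
  have q2 := hs 2
  have q4 := hs 4
  have r3 := P.right_angle 3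
  have r4 := P.right_angle 4
  simp only [show (0 + 1 : Fin 6) = 1 from rfl, show (2 + 1 : Fin 6) = 3 from rfl,
    show (3 + 1 : Fin 6) = 4 from rfl, show (4 + 1 : Fin 6) = 5 from rfl,
    show (3 - 1 : Fin 6) = 2 from rfl, show (4 - 1 : Fin 6) = 3 from rfl]
    at c0 c2 c3 c4 q0 q2 q4 r3 r4
  rw [lorentz_tangentTowards (hv _), lorentz_comm (P.vertex 3) (P.vertex 2)] at r3
  rw [lorentz_tangentTowards (hv _), lorentz_comm (P.vertex 4) (P.vertex 3)] at r4
  -- The tangent vectors along side 0 at its two ends have a product that depends on cosh of side 0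
  -- only. By `h1` and `h2` they are carried across the black sides 1 and 5 to the vertices 2 and 5.
  -- The one product still missing, that of vertices 2 and 5, comes from `g3`, which uses the black
  -- side 3.
  have g1 := congrArg₂ lorentz h1 h2.symm
  have g3 := congrArg (lorentz (P.vertex 2)) h3
  have e01 : lorentz (P.vertex 0) (P.vertex 1) = -Real.cosh (P.sideLength 0) := by linarith
  have e23 : lorentz (P.vertex 2) (P.vertex 3) = -Real.cosh (P.sideLength 2) := by linarith
  have e34 : lorentz (P.vertex 3) (P.vertex 4) = -Real.cosh (P.sideLength 3) := by linarith
  have e45 : lorentz (P.vertex 4) (P.vertex 5) = -Real.cosh (P.sideLength 4) := by linarith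
  have e24 : lorentz (P.vertex 2) (P.vertex 4) =
      -(Real.cosh (P.sideLength 2) * Real.cosh (P.sideLength 3)) := by
    rw [e23, e34] at r3; linarith
  have e35 : lorentz (P.vertex 3) (P.vertex 5) =
      -(Real.cosh (P.sideLength 3) * Real.cosh (P.sideLength 4)) := by
    rw [e34, e45] at r4; linarith
  simp only [tangentTowards, lorentz_add_left, lorentz_add_right, lorentz_smul_left,
    lorentz_smul_right, hv, lorentz_comm (P.vertex 1) (P.vertex 0),
    lorentz_comm (P.vertex 3) (P.vertex 2), lorentz_comm (P.vertex 5) (P.vertex 4),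
    e01, e23, e34, e45, e24, e35] at g1 g3
  rw [e01] at q0
  rw [e23] at q2
  rw [e45] at q4
  generalize Real.cosh (P.sideLength 0) = C0 at *
  generalize Real.cosh (P.sideLength 2) = C2 at *
  generalize Real.cosh (P.sideLength 3) = C3 at *
  generalize Real.cosh (P.sideLength 4) = C4 at *
  generalize Real.sinh (P.sideLength 0) = S0 at *
  generalize Real.sinh (P.sideLength 2) = S2 at *
  generalize Real.sinh (P.sideLength 4) = S4 at *
  have e25 : lorentz (P.vertex 2) (P.vertex 5) = S2 * S4 - C2 * C3 * C4 := by
    refine mul_left_cancel₀ s2.ne' ?_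
    linear_combination -g3 - S4 * q2
  rw [e25] at g1
  refine mul_left_cancel₀ (mul_pos (mul_pos s0 s0) (mul_pos s2 s4)).ne' ?_
  linear_combination -g1 + (C0 * S2 * S4) * q0 - S0 ^ 2 * C3 * S4 ^ 2 * q2
    - S0 ^ 2 * C3 * (C2 ^ 2 - 1) * q4

end RightAngledHexagon

/-! ### Existence of hexagons with prescribed red sides. -/

/-- The vertices of a right-angled hexagon, up to positive factors, in terms of the inward normals
of the lines through its three black sides. -/
def hexagonCoeff (A B C : ℝ) : Fin 6 → Fin 3 → ℝ :=
  ![![-1, 0, -A], ![-A, 0, -1], ![-B, -1, 0], ![-1, -B, 0], ![0, -C, -1], ![0, -1, -C]]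

theorem det_hexagonCoeff_neg {A B C : ℝ} (hA : 1 < A) (hB : 1 < B) (hC : 1 < C) (i j : Fin 6)
    (h1 : j ≠ i) (h2 : j ≠ i + 1) :
    Matrix.det (Matrix.of ![hexagonCoeff A B C i, hexagonCoeff A B C (i + 1),
      hexagonCoeff A B C j]) < 0 := by
  have hA' : 0 < A * A - 1 := by nlinarith
  have hB' : 0 < B * B - 1 := by nlinarith
  have hC' : 0 < C * C - 1 := by nlinarith
  fin_cases i <;> fin_cases j <;> simp at h1 h2 <;>
    simp [hexagonCoeff, Matrix.det_fin_three] <;> nlinarith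

/-- The Lorentz form in the basis of normals of the black sides. -/
theorem lorentz_vecMul {N : Matrix (Fin 3) (Fin 3) ℝ} {A B C : ℝ} (h00 : lorentz (N 0) (N 0) = 1)
    (h11 : lorentz (N 1) (N 1) = 1) (h22 : lorentz (N 2) (N 2) = 1)
    (h01 : lorentz (N 0) (N 1) = -B) (h02 : lorentz (N 0) (N 2) = -A)
    (h12 : lorentz (N 1) (N 2) = -C) (x y : Fin 3 → ℝ) :
    lorentz (x ᵥ* N) (y ᵥ* N) = x 0 * y 0 + x 1 * y 1 + x 2 * y 2 - B * (x 0 * y 1 + x 1 * y 0)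
      - A * (x 0 * y 2 + x 2 * y 0) - C * (x 1 * y 2 + x 2 * y 1) := by
  have e (z : Fin 3 → ℝ) : z ᵥ* N = z 0 • N 0 + z 1 • N 1 + z 2 • N 2 := by
    funext i
    simp [Matrix.vecMul, dotProduct, Fin.sum_univ_three]
  rw [e, e]
  simp only [lorentz_add_left, lorentz_add_right, lorentz_smul_left, lorentz_smul_right, h00, h11,
    h22, h01, h02, h12, lorentz_comm (N 1) (N 0), lorentz_comm (N 2) (N 0),
    lorentz_comm (N 2) (N 1)]
  ring

theorem det_smul_vecMul (N : Matrix (Fin 3) (Fin 3) ℝ) (x y z : Fin 3 → ℝ) (a b c : ℝ) :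
    Matrix.det (Matrix.of ![a • (x ᵥ* N), b • (y ᵥ* N), c • (z ᵥ* N)]) =
      a * b * c * (Matrix.det (Matrix.of ![x, y, z]) * N.det) := by
  rw [← Matrix.det_mul]
  simp [Matrix.det_fin_three, Matrix.vecMul, dotProduct, Fin.sum_univ_three]
  ring

theorem RightAngledHexagon.exists_sideLength {a b c : ℝ} (ha : 0 < a) (hb : 0 < b) (hc : 0 < c) :
    ∃ P : RightAngledHexagon,
      P.sideLength 0 = a ∧ P.sideLength 2 = b ∧ P.sideLength 4 = c := by
  have hA : 1 < Real.cosh a := Real.one_lt_cosh.2 ha.ne'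
  have hB : 1 < Real.cosh b := Real.one_lt_cosh.2 hb.ne'
  have hC : 1 < Real.cosh c := Real.one_lt_cosh.2 hc.ne'
  have sa := Real.sinh_pos_iff.2 ha
  have sb := Real.sinh_pos_iff.2 hb
  have sc := Real.sinh_pos_iff.2 hc
  have qa := Real.sinh_sq a
  have qb := Real.sinh_sq b
  have qc := Real.sinh_sq c
  have ia := Real.arcosh_cosh ha.le
  have ib := Real.arcosh_cosh hb.le
  have ic := Real.arcosh_cosh hc.le
  generalize Real.cosh a = A at *
  generalize Real.cosh b = B at *
  generalize Real.cosh c = C at *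
  generalize Real.sinh a = s at *
  generalize Real.sinh b = t at *
  generalize Real.sinh c = u at *
  have hD : t * u < A + B * C := by
    nlinarith [mul_pos sb sc, mul_pos (sub_pos.2 hB) (sub_pos.2 hC),
      show (t * u) ^ 2 = (B ^ 2 - 1) * (C ^ 2 - 1) by rw [mul_pow, qb, qc],
      sq_nonneg (B - C)]
  -- By the law of cosines `D` has to be cosh of the black side 3, and `z` is then its sinh.
  obtain ⟨D, hD1, hDe⟩ : ∃ D : ℝ, 1 < D ∧ D * (t * u) = A + B * C :=
    ⟨(A + B * C) / (t * u), by rwa [one_lt_div (mul_pos sb sc)],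
      div_mul_cancel₀ _ (mul_pos sb sc).ne'⟩
  obtain ⟨z, hz, hzz⟩ : ∃ z : ℝ, 0 < z ∧ z ^ 2 = D ^ 2 - 1 :=
    ⟨√(D ^ 2 - 1), Real.sqrt_pos.2 (by nlinarith), Real.sq_sqrt (by nlinarith)⟩
  -- Rows with the Gram matrix that has 1 on the diagonal and -cosh of the red sides off it. The
  -- second row is normalized to a coordinate vector; the choice of `D` and `z` makes the products
  -- with the third row right.
  let N : Matrix (Fin 3) (Fin 3) ℝ :=
    Matrix.of ![![-t, 0, -B], ![0, 0, 1], ![-(u * D), -(u * z), -C]]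
  have hN : N.det < 0 := by
    have : N.det = -(t * u * z) := by simp [N, Matrix.det_fin_three]; ring
    rw [this]
    exact neg_neg_of_pos (by positivity)
  have hL := lorentz_vecMul (N := N) (A := A) (B := B) (C := C)
    (by simp [N, lorentz]; linear_combination -qb) (by simp [N, lorentz])
    (by simp [N, lorentz]; linear_combination u ^ 2 * hzz - qc) (by simp [N, lorentz])
    (by simp [N, lorentz]; linear_combination -hDe) (by simp [N, lorentz])
  let r : Fin 6 → ℝ := ![s⁻¹, s⁻¹, t⁻¹, t⁻¹, u⁻¹, u⁻¹]
  have hr : ∀ i, 0 < r i := by intro i; fin_cases i <;> simp [r] <;> assumption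
  let v : Fin 6 → Fin 3 → ℝ := fun i => r i • (hexagonCoeff A B C i ᵥ* N)
  have hv (i j : Fin 6) : lorentz (v i) (v j) = r i * (r j *
      lorentz (hexagonCoeff A B C i ᵥ* N) (hexagonCoeff A B C j ᵥ* N)) := by
    simp only [v, lorentz_smul_left, lorentz_smul_right]
    ring
  have hA0 : A ^ 2 - 1 ≠ 0 := by rw [← qa]; positivity
  have hB0 : B ^ 2 - 1 ≠ 0 := by rw [← qb]; positivity
  have hC0 : C ^ 2 - 1 ≠ 0 := by rw [← qc]; positivity
  have hself (i : Fin 6) : lorentz (v i) (v i) = -1 := by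
    rw [hv, hL]
    fin_cases i <;> simp [r, hexagonCoeff] <;> field_simp <;> simp only [qa, qb, qc] <;> ring
  have hangle (i : Fin 6) : lorentz (tangentTowards (v i) (v (i - 1)))
      (tangentTowards (v i) (v (i + 1))) = 0 := by
    rw [lorentz_tangentTowards (hself i), hv, hv, hv, hL, hL, hL]
    fin_cases i <;> simp [r, hexagonCoeff] <;> field_simp <;> simp only [qa, qb, qc] <;> ring
  refine ⟨⟨v, fun i => ⟨hself i, ?_⟩, fun i j h1 h2 => ?_, hangle⟩, ?_, ?_, ?_⟩
  · have : 0 < (hexagonCoeff A B C i ᵥ* N) 0 := by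
      fin_cases i <;> simp [hexagonCoeff, N, Matrix.vecMul, dotProduct, Fin.sum_univ_three] <;>
        positivity
    exact mul_pos (hr i) this
  · simp only [v]
    rw [det_smul_vecMul]
    exact mul_pos (mul_pos (mul_pos (hr _) (hr _)) (hr _))
      (mul_pos_of_neg_of_neg (det_hexagonCoeff_neg hA hB hC i j h1 h2) hN)
  · rw [← ia]
    simp only [sideLength, hypDist, hv, hL]
    congr 1
    simp [r, hexagonCoeff]
    field_simp
    rw [qa]; ring
  · rw [← ib]
    simp only [sideLength, hypDist, hv, hL]
    congr 1
    simp [r, hexagonCoeff, show (2 + 1 : Fin 6) = 3 from rfl]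
    field_simp
    rw [qb]; ring
  · rw [← ic]
    simp only [sideLength, hypDist, hv, hL]
    congr 1
    simp [r, hexagonCoeff, show (4 + 1 : Fin 6) = 5 from rfl]
    field_simp
    rw [qc]; ring

/-! ### The black side as a function of the red sides, and its derivative. -/

/-- The length of a black side in terms of the hyperbolic cosines of the lengths of the red
sides. -/
noncomputable def blackArc (A B C : ℝ) : ℝ :=
  Real.arcosh ((A + B * C) / √((B ^ 2 - 1) * (C ^ 2 - 1)))

/-- Existence of a hexagon gives meaning to the choice made by `Classical.epsilon`; the law of
cosines, solved for the black side, shows that the choice does not matter. -/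
theorem blackLength_eq {a b c : ℝ} (ha : 0 < a) (hb : 0 < b) (hc : 0 < c) :
    blackLength a b c = blackArc (Real.cosh a) (Real.cosh b) (Real.cosh c) := by
  obtain ⟨P₀, h0, h2, h4⟩ := RightAngledHexagon.exists_sideLength ha hb hc
  obtain ⟨P, h0, h2, h4, h3⟩ := Classical.epsilon_spec (p := fun θ : ℝ => ∃ P : RightAngledHexagon,
    P.sideLength 0 = a ∧ P.sideLength 2 = b ∧ P.sideLength 4 = c ∧ P.sideLength 3 = θ)
    ⟨_, P₀, h0, h2, h4, rfl⟩
  change P.sideLength 3 = blackLength a b c at h3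
  have hlaw := P.cosh_law
  have hpos := P.sideLength_pos 3
  rw [h0, h2, h4, h3] at hlaw
  rw [h3] at hpos
  have sb := Real.sinh_pos_iff.2 hb
  have sc := Real.sinh_pos_iff.2 hc
  rw [blackArc, ← Real.sinh_sq, ← Real.sinh_sq, ← mul_pow, Real.sqrt_sq (by positivity), hlaw,
    ← Real.arcosh_cosh hpos.le]
  congr 1
  rw [Real.cosh_arcosh (Real.one_le_cosh _)]
  field_simp
  ring

/-- The square of `sinh θ sinh b sinh c` in the right-angled hexagon with red sides `a`, `b`, `c`,
as a function of the hyperbolic cosines of `a`, `b`, `c`. -/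
def hexagonDisc (A B C : ℝ) : ℝ := A ^ 2 + B ^ 2 + C ^ 2 + 2 * A * B * C - 1

theorem hexagonDisc_rotate (A B C : ℝ) : hexagonDisc B C A = hexagonDisc A B C := by
  simp only [hexagonDisc]; ring

theorem hexagonDisc_pos {A B C : ℝ} (hA : 1 < A) (hB : 1 < B) (hC : 1 < C) :
    0 < hexagonDisc A B C := by
  have : 0 < A * B * C := by positivity
  simp only [hexagonDisc]
  nlinarith

/-- The derivative of `blackArc` when the derivatives of the hyperbolic cosines are
`2 (1 + A) a`, `2 (1 + B) b`, `2 (1 + C) c`. -/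
noncomputable def blackArcDeriv (A B C a b c : ℝ) : ℝ :=
  2 / √(hexagonDisc A B C) *
    ((1 + A) * a - (C + A * B) / (B - 1) * b - (B + A * C) / (C - 1) * c)

theorem one_lt_cosh_blackArc {A B C : ℝ} (hA : 1 < A) (hB : 1 < B) (hC : 1 < C) :
    1 < (A + B * C) / √((B ^ 2 - 1) * (C ^ 2 - 1)) := by
  have hB' : 0 < B ^ 2 - 1 := by nlinarith
  have hC' : 0 < C ^ 2 - 1 := by nlinarith
  rw [one_lt_div (Real.sqrt_pos.2 (by positivity)), Real.sqrt_lt' (by positivity)]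
  nlinarith [show 0 < A * B * C by positivity]

theorem cosh_blackArc {A B C : ℝ} (hA : 1 < A) (hB : 1 < B) (hC : 1 < C) :
    Real.cosh (blackArc A B C) = (A + B * C) / √((B ^ 2 - 1) * (C ^ 2 - 1)) :=
  Real.cosh_arcosh (one_lt_cosh_blackArc hA hB hC).le

theorem blackArc_pos {A B C : ℝ} (hA : 1 < A) (hB : 1 < B) (hC : 1 < C) : 0 < blackArc A B C :=
  Real.arcosh_pos (one_lt_cosh_blackArc hA hB hC)

theorem contDiffAt_blackArc {E : Type*} [NormedAddCommGroup E] [NormedSpace ℝ E] {f g h : E → ℝ}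
    {n : WithTop ℕ∞} {x : E} (hf : ContDiffAt ℝ n f x) (hg : ContDiffAt ℝ n g x)
    (hh : ContDiffAt ℝ n h x) (hA : 1 < f x) (hB : 1 < g x) (hC : 1 < h x) :
    ContDiffAt ℝ n (fun y => blackArc (f y) (g y) (h y)) x := by
  have hB' : 0 < g x ^ 2 - 1 := by nlinarith
  have hC' : 0 < h x ^ 2 - 1 := by nlinarith
  have h1 : ContDiffAt ℝ n (fun y => √((g y ^ 2 - 1) * (h y ^ 2 - 1))) x :=
    (((hg.pow 2).sub contDiffAt_const).mul ((hh.pow 2).sub contDiffAt_const)).sqrt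
      (by positivity)
  exact (Real.contDiffAt_arcosh (one_lt_cosh_blackArc hA hB hC)).comp x
    ((hf.add (hg.mul hh)).div h1 (Real.sqrt_pos.2 (by positivity)).ne')

theorem hasDerivAt_blackArc {f g h : ℝ → ℝ} {a b c x : ℝ}
    (hf : HasDerivAt f (2 * (1 + f x) * a) x) (hg : HasDerivAt g (2 * (1 + g x) * b) x)
    (hh : HasDerivAt h (2 * (1 + h x) * c) x) (hA : 1 < f x) (hB : 1 < g x) (hC : 1 < h x) :
    HasDerivAt (fun y => blackArc (f y) (g y) (h y))
      (blackArcDeriv (f x) (g x) (h x) a b c) x := by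
  have hB' : 0 < g x ^ 2 - 1 := by nlinarith
  have hC' : 0 < h x ^ 2 - 1 := by nlinarith
  have hY : 0 < (g x ^ 2 - 1) * (h x ^ 2 - 1) := mul_pos hB' hC'
  have hy := Real.sqrt_pos.2 hY
  have hyy := Real.sq_sqrt hY.le
  have hD := hexagonDisc_pos hA hB hC
  have hd := Real.sqrt_pos.2 hD
  have h1 := (((hg.pow 2).sub_const 1).mul ((hh.pow 2).sub_const 1)).sqrt hY.ne'
  have h2 := (hf.add (hg.mul hh)).div h1 hy.ne'
  have h3 := (Real.hasDerivAt_arcosh (one_lt_cosh_blackArc hA hB hC)).comp x h2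
  refine HasDerivAt.congr_deriv h3 ?_
  -- This is sinh of the black side, because (A + BC)² - (B² - 1)(C² - 1) = `hexagonDisc A B C`.
  have e : √(((f x + g x * h x) / √((g x ^ 2 - 1) * (h x ^ 2 - 1))) ^ 2 - 1) =
      √(hexagonDisc (f x) (g x) (h x)) / √((g x ^ 2 - 1) * (h x ^ 2 - 1)) := by
    rw [← Real.sqrt_div hD.le, div_pow, hyy]
    congr 1
    rw [hexagonDisc]
    field_simp
    ring
  rw [e, blackArcDeriv]
  have k1 : g x - 1 ≠ 0 := by linarith
  have k2 : h x - 1 ≠ 0 := by linarith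
  simp only [Pi.add_apply, Pi.mul_apply, Pi.pow_apply, Nat.cast_ofNat, Nat.add_one_sub_one, pow_one]
  generalize √((g x ^ 2 - 1) * (h x ^ 2 - 1)) = y at *
  generalize √(hexagonDisc (f x) (g x) (h x)) = d at *
  generalize f x = A at *
  generalize g x = B at *
  generalize h x = C at *
  have k3 : B + 1 ≠ 0 := by linarith
  have k4 : C + 1 ≠ 0 := by linarith
  have hyy' : y ^ 2 = (B - 1) * (B + 1) * ((C - 1) * (C + 1)) := by rw [hyy]; ring
  have e2 (u u' Y' : ℝ) : (d / y)⁻¹ * ((u' * y - u * (Y' / (2 * y))) / y ^ 2) =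
      (u' * y ^ 2 - u * Y' / 2) / (y ^ 2 * d) := by
    field_simp
  rw [e2, hyy']
  field_simp
  ring

/-- Here a, b, c vary the conformal factors at the three black sides. A red side varies by the sum
over its two ends, whence b + c for the red side opposite to a. Symmetry is possible because the
common denominator `hexagonDisc` is invariant under rotation. -/
theorem blackArcDeriv_form_symm {A B C : ℝ} (hA : 1 < A) (hB : 1 < B) (hC : 1 < C)
    (a b c a' b' c' : ℝ) :
    blackArcDeriv A B C (b + c) (c + a) (a + b) * a' +
      blackArcDeriv B C A (c + a) (a + b) (b + c) * b' +
      blackArcDeriv C A B (a + b) (b + c) (c + a) * c' =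
    blackArcDeriv A B C (b' + c') (c' + a') (a' + b') * a +
      blackArcDeriv B C A (c' + a') (a' + b') (b' + c') * b +
      blackArcDeriv C A B (a' + b') (b' + c') (c' + a') * c := by
  have hA' : A - 1 ≠ 0 := by linarith
  have hB' : B - 1 ≠ 0 := by linarith
  have hC' : C - 1 ≠ 0 := by linarith
  simp only [blackArcDeriv, hexagonDisc_rotate B C A, hexagonDisc_rotate A B C]
  field_simp
  ring

/-- The core of the theorem: the Jacobian of one hexagon as minus a sum of squares with positive
coefficients. The last three squares alone make it definite. -/
theorem blackArcDeriv_form_eq {A B C : ℝ} (hA : 1 < A) (hB : 1 < B) (hC : 1 < C) (a b c : ℝ) :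
    blackArcDeriv A B C (b + c) (c + a) (a + b) * a +
      blackArcDeriv B C A (c + a) (a + b) (b + c) * b +
      blackArcDeriv C A B (a + b) (b + c) (c + a) * c =
    -(2 / √(hexagonDisc A B C) * ((a - b) ^ 2 + (b - c) ^ 2 + (c - a) ^ 2 +
      (B + C) / (A - 1) * (b + c) ^ 2 + (C + A) / (B - 1) * (c + a) ^ 2 +
      (A + B) / (C - 1) * (a + b) ^ 2 +
      2 * ((A - 1) * a ^ 2 + (B - 1) * b ^ 2 + (C - 1) * c ^ 2))) := by
  have hA' : A - 1 ≠ 0 := by linarith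
  have hB' : B - 1 ≠ 0 := by linarith
  have hC' : C - 1 ≠ 0 := by linarith
  simp only [blackArcDeriv, hexagonDisc_rotate B C A, hexagonDisc_rotate A B C]
  field_simp
  ring

theorem blackArcDeriv_form_le {A B C : ℝ} (hA : 1 < A) (hB : 1 < B) (hC : 1 < C) (a b c : ℝ) :
    blackArcDeriv A B C (b + c) (c + a) (a + b) * a +
      blackArcDeriv B C A (c + a) (a + b) (b + c) * b +
      blackArcDeriv C A B (a + b) (b + c) (c + a) * c ≤
    -(2 / √(hexagonDisc A B C) *
      (2 * ((A - 1) * a ^ 2 + (B - 1) * b ^ 2 + (C - 1) * c ^ 2))) := by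
  rw [blackArcDeriv_form_eq hA hB hC]
  have hA' : 0 < A - 1 := by linarith
  have hB' : 0 < B - 1 := by linarith
  have hC' : 0 < C - 1 := by linarith
  have h1 : 0 ≤ (a - b) ^ 2 + (b - c) ^ 2 + (c - a) ^ 2 + (B + C) / (A - 1) * (b + c) ^ 2 +
      (C + A) / (B - 1) * (c + a) ^ 2 + (A + B) / (C - 1) * (a + b) ^ 2 := by positivity
  have h2 : 0 ≤ 2 / √(hexagonDisc A B C) := by positivity
  rw [neg_le_neg_iff]
  exact mul_le_mul_of_nonneg_left (by linarith) h2

theorem blackArcDeriv_form_neg {A B C : ℝ} (hA : 1 < A) (hB : 1 < B) (hC : 1 < C) {a b c : ℝ}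
    (h : a ≠ 0 ∨ b ≠ 0 ∨ c ≠ 0) :
    blackArcDeriv A B C (b + c) (c + a) (a + b) * a +
      blackArcDeriv B C A (c + a) (a + b) (b + c) * b +
      blackArcDeriv C A B (a + b) (b + c) (c + a) * c < 0 := by
  refine (blackArcDeriv_form_le hA hB hC a b c).trans_lt (neg_neg_of_pos (mul_pos
    (div_pos two_pos (Real.sqrt_pos.2 (hexagonDisc_pos hA hB hC))) (mul_pos two_pos ?_)))
  have hA' : 0 < A - 1 := by linarith
  have hB' : 0 < B - 1 := by linarith
  have hC' : 0 < C - 1 := by linarith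
  rcases h with h | h | h
  · have : 0 < (A - 1) * a ^ 2 := by positivity
    positivity
  · have : 0 < (B - 1) * b ^ 2 := by positivity
    positivity
  · have : 0 < (C - 1) * c ^ 2 := by positivity
    positivity

/-! ### Degeneration estimates for one hexagon. -/

/-- A collapsing red side forces the adjacent black sides to blow up. Dropping A and using C² - 1 <
C² leaves B² ≤ c²(B² - 1), a bound that keeps B away from 1 independently of A and C. -/
theorem sq_ge_of_cosh_blackArc_le {A B C c : ℝ} (hA : 1 < A) (hB : 1 < B) (hC : 1 < C) (hc : 1 < c)
    (h : Real.cosh (blackArc A B C) ≤ c) : c ^ 2 / (c ^ 2 - 1) ≤ B ^ 2 := by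
  have hB' : 0 < B ^ 2 - 1 := by nlinarith
  have hC' : 0 < C ^ 2 - 1 := by nlinarith
  have hc' : 0 < c ^ 2 - 1 := by nlinarith
  have hY : 0 < (B ^ 2 - 1) * (C ^ 2 - 1) := mul_pos hB' hC'
  rw [cosh_blackArc hA hB hC, div_le_iff₀ (Real.sqrt_pos.2 hY)] at h
  have h1 : B * C ≤ c * √((B ^ 2 - 1) * (C ^ 2 - 1)) := by linarith
  have h2 : (B * C) ^ 2 ≤ (c * √((B ^ 2 - 1) * (C ^ 2 - 1))) ^ 2 :=
    pow_le_pow_left₀ (by positivity) h1 2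
  rw [mul_pow, mul_pow, Real.sq_sqrt hY.le] at h2
  have h3 : B ^ 2 * C ^ 2 ≤ c ^ 2 * (B ^ 2 - 1) * C ^ 2 := by
    have : 0 < c ^ 2 * (B ^ 2 - 1) := by positivity
    nlinarith
  have h4 := le_of_mul_le_mul_right h3 (by positivity)
  rw [div_le_iff₀ hc']
  linarith

theorem le_mul_of_cosh_blackArc_le {A B C c : ℝ} (hA : 1 < A) (hB : 1 < B) (hC : 1 < C)
    (hc : 1 < c) (h : Real.cosh (blackArc A B C) ≤ c) : A ≤ c * (B * C) := by
  have hB' : 0 < B ^ 2 - 1 := by nlinarith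
  have hC' : 0 < C ^ 2 - 1 := by nlinarith
  have hY : 0 < (B ^ 2 - 1) * (C ^ 2 - 1) := mul_pos hB' hC'
  rw [cosh_blackArc hA hB hC, div_le_iff₀ (Real.sqrt_pos.2 hY)] at h
  have h1 : √((B ^ 2 - 1) * (C ^ 2 - 1)) ≤ B * C := by
    rw [Real.sqrt_le_left (by positivity)]
    nlinarith
  have h2 : 0 < B * C := by positivity
  nlinarith

/-- If A is small compared with BC, while B and C are large, then cosh of the black side is at most
(1 + ε)/(1 - ε). Read backwards, a black side of definite length bounds ε from below. -/
theorem sub_one_le_of_le_cosh_blackArc {A B C c ε : ℝ} (hA : 1 < A) (hB : 1 < B) (hC : 1 < C)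
    (hc : 1 < c) (h : c ≤ Real.cosh (blackArc A B C)) (h1 : A ≤ ε * (B * C))
    (h2 : 1 ≤ ε * B ^ 2) (h3 : 1 ≤ ε * C ^ 2) : c - 1 ≤ ε * (c + 1) := by
  have hB' : 0 < B ^ 2 - 1 := by nlinarith
  have hC' : 0 < C ^ 2 - 1 := by nlinarith
  have hY : 0 < (B ^ 2 - 1) * (C ^ 2 - 1) := mul_pos hB' hC'
  rw [cosh_blackArc hA hB hC, le_div_iff₀ (Real.sqrt_pos.2 hY)] at h
  rcases le_or_gt 1 ε with hε | hε
  · nlinarith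
  have h4 : (1 - ε) * (B * C) ≤ √((B ^ 2 - 1) * (C ^ 2 - 1)) := by
    refine Real.le_sqrt_of_sq_le ?_
    have : ((1 - ε) * (B * C)) ^ 2 = ((1 - ε) * B ^ 2) * ((1 - ε) * C ^ 2) := by ring
    rw [this]
    have hε' : 0 < 1 - ε := by linarith
    exact mul_le_mul (by linarith) (by linarith) (by positivity) hB'.le
  have h5 : 0 < B * C := by positivity
  have h6 : c * ((1 - ε) * (B * C)) ≤ (1 + ε) * (B * C) := by nlinarith
  rw [← mul_assoc] at h6
  have := le_of_mul_le_mul_right h6 h5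
  linarith

/-! ### Boundary lengths of glued hexagons and their Jacobian. -/

namespace HexagonGluing

variable {F β : Type*}

/-- The logarithm of the hyperbolic cosine of half the length of the red side `r`, for the vertex
scaling by `w` of a metric for which it is `x r`. Here `p c` is the boundary component of the black
side `c`. -/
def logCosh (p : F × Fin 3 → β) (x : F × Fin 3 → ℝ) (w : β → ℝ) (r : F × Fin 3) : ℝ :=
  w (p (r.1, r.2 + 1)) + w (p (r.1, r.2 + 2)) + x r

/-- The hyperbolic cosine of the length of a red side. -/
noncomputable def redCosh (p : F × Fin 3 → β) (x : F × Fin 3 → ℝ) (w : β → ℝ)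
    (r : F × Fin 3) : ℝ :=
  2 * Real.exp (2 * logCosh p x w r) - 1

/-- The scaling factors for which all red sides have positive length. -/
def domain (p : F × Fin 3 → β) (x : F × Fin 3 → ℝ) : Set (β → ℝ) :=
  {w | ∀ r, 0 < logCosh p x w r}

/-- The length of a black side. -/
noncomputable def arc (p : F × Fin 3 → β) (x : F × Fin 3 → ℝ) (w : β → ℝ) (c : F × Fin 3) : ℝ :=
  blackArc (redCosh p x w c) (redCosh p x w (c.1, c.2 + 1)) (redCosh p x w (c.1, c.2 + 2))

/-- The length of a boundary component. -/
noncomputable def boundaryLength [Fintype F] [DecidableEq β] (p : F × Fin 3 → β)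
    (x : F × Fin 3 → ℝ) (w : β → ℝ) (i : β) : ℝ :=
  ∑ c : F × Fin 3, if p c = i then arc p x w c else 0

variable {p : F × Fin 3 → β} {x : F × Fin 3 → ℝ} {w : β → ℝ}

/-- The factors at the other two black sides of the face cancel. So the ratio A/(BC) of a hexagon
controls one single w_i. -/
theorem logCosh_add_sub (c : F × Fin 3) :
    logCosh p x w (c.1, c.2 + 1) + logCosh p x w (c.1, c.2 + 2) - logCosh p x w c =
      2 * w (p c) + x (c.1, c.2 + 1) + x (c.1, c.2 + 2) - x c := by
  obtain ⟨f, k⟩ := c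
  fin_cases k <;> simp [logCosh] <;> ring_nf

theorem one_lt_redCosh (hw : w ∈ domain p x) (r : F × Fin 3) : 1 < redCosh p x w r := by
  have := Real.one_lt_exp_iff.2 (mul_pos two_pos (hw r))
  rw [redCosh]
  linarith

theorem arc_pos (hw : w ∈ domain p x) (c : F × Fin 3) : 0 < arc p x w c :=
  blackArc_pos (one_lt_redCosh hw _) (one_lt_redCosh hw _) (one_lt_redCosh hw _)

theorem convex_domain : Convex ℝ (domain p x) := by
  intro u hu v hv a b ha hb hab r
  have h1 := hu r
  have h2 := hv r
  have : logCosh p x (a • u + b • v) r = a * logCosh p x u r + b * logCosh p x v r := by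
    simp only [logCosh, Pi.add_apply, Pi.smul_apply, smul_eq_mul]
    linear_combination -(x r) * hab
  rw [this]
  rcases ha.eq_or_lt with rfl | ha
  · have : b = 1 := by linarith
    subst this
    simpa using h2
  · exact add_pos_of_pos_of_nonneg (mul_pos ha h1) (mul_nonneg hb h2.le)

@[fun_prop]
theorem continuous_logCosh (r : F × Fin 3) : Continuous fun w => logCosh p x w r := by
  unfold logCosh; fun_prop

theorem contDiff_redCosh [Fintype β] {n : WithTop ℕ∞} (r : F × Fin 3) :
    ContDiff ℝ n fun w => redCosh p x w r := by
  unfold redCosh logCosh; fun_prop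

theorem hasDerivAt_redCosh (v : β → ℝ) (r : F × Fin 3) :
    HasDerivAt (fun t : ℝ => redCosh p x (w + t • v) r)
      (2 * (1 + redCosh p x (w + (0 : ℝ) • v) r) *
        (v (p (r.1, r.2 + 1)) + v (p (r.1, r.2 + 2)))) 0 := by
  have h1 : HasDerivAt (fun t : ℝ => 2 * logCosh p x (w + t • v) r)
      (2 * (v (p (r.1, r.2 + 1)) + v (p (r.1, r.2 + 2)))) 0 := by
    have : (fun t : ℝ => 2 * logCosh p x (w + t • v) r) =
        fun t => 2 * logCosh p x w r + t * (2 * (v (p (r.1, r.2 + 1)) + v (p (r.1, r.2 + 2)))) := by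
      funext t
      simp only [logCosh, Pi.add_apply, Pi.smul_apply, smul_eq_mul]
      ring
    rw [this]
    simpa using ((hasDerivAt_id (0 : ℝ)).mul_const
      (2 * (v (p (r.1, r.2 + 1)) + v (p (r.1, r.2 + 2))))).const_add (2 * logCosh p x w r)
  refine ((h1.exp.const_mul 2).sub_const 1).congr_deriv ?_
  simp only [redCosh]
  ring

theorem contDiffAt_arc [Fintype β] {n : WithTop ℕ∞} (hw : w ∈ domain p x) (c : F × Fin 3) :
    ContDiffAt ℝ n (fun w => arc p x w c) w :=
  contDiffAt_blackArc (contDiff_redCosh _).contDiffAt (contDiff_redCosh _).contDiffAt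
    (contDiff_redCosh _).contDiffAt (one_lt_redCosh hw _) (one_lt_redCosh hw _)
    (one_lt_redCosh hw _)

variable [Fintype F]

theorem isOpen_domain : IsOpen (domain p x) := by
  have : domain p x = ⋂ r, {w | 0 < logCosh p x w r} := by ext; simp [domain]
  rw [this]
  exact isOpen_iInter_of_finite fun r => isOpen_lt continuous_const (continuous_logCosh r)

theorem arc_le_boundaryLength [DecidableEq β] (hw : w ∈ domain p x) (c : F × Fin 3) :
    arc p x w c ≤ boundaryLength p x w (p c) := by
  have := Finset.single_le_sum (f := fun d => if p d = p c then arc p x w d else 0)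
    (fun d _ => by split_ifs; exacts [(arc_pos hw d).le, le_rfl]) (Finset.mem_univ c)
  simpa [boundaryLength] using this

theorem boundaryLength_pos [DecidableEq β] (hp : Function.Surjective p) (hw : w ∈ domain p x)
    (i : β) : 0 < boundaryLength p x w i := by
  obtain ⟨c, rfl⟩ := hp i
  exact (arc_pos hw c).trans_le (arc_le_boundaryLength hw c)

variable [Fintype β]

theorem contDiffAt_boundaryLength [DecidableEq β] {n : WithTop ℕ∞} (hw : w ∈ domain p x) :
    ContDiffAt ℝ n (boundaryLength p x) w := by
  refine contDiffAt_pi.2 fun i => ContDiffAt.sum fun c _ => ?_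
  split_ifs
  exacts [contDiffAt_arc hw c, contDiffAt_const]

/-- The derivative of the length of the black side `c` in the direction `v`. -/
noncomputable def arcDeriv (p : F × Fin 3 → β) (x : F × Fin 3 → ℝ) (w v : β → ℝ)
    (c : F × Fin 3) : ℝ :=
  blackArcDeriv (redCosh p x w c) (redCosh p x w (c.1, c.2 + 1)) (redCosh p x w (c.1, c.2 + 2))
    (v (p (c.1, c.2 + 1)) + v (p (c.1, c.2 + 2))) (v (p (c.1, c.2 + 2)) + v (p c))
    (v (p c) + v (p (c.1, c.2 + 1)))

theorem fderiv_boundaryLength [DecidableEq β] (hw : w ∈ domain p x) (v : β → ℝ) (i : β) :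
    fderiv ℝ (boundaryLength p x) w v i = ∑ c, if p c = i then arcDeriv p x w v c else 0 := by
  have e : w + (0 : ℝ) • v = w := by simp
  have h1 := ((contDiffAt_boundaryLength (n := 1) hw).differentiableAt one_ne_zero).hasFDerivAt
  have h2 : HasDerivAt (fun t : ℝ => boundaryLength p x (w + t • v))
      (fderiv ℝ (boundaryLength p x) w v) 0 := by
    have h3 : HasDerivAt (fun t : ℝ => w + t • v) v 0 := by
      simpa using ((hasDerivAt_id (0 : ℝ)).smul_const v).const_add w
    exact HasFDerivAt.comp_hasDerivAt (f := fun t : ℝ => w + t • v) 0 (by rwa [e]) h3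
  have h4 : HasDerivAt (fun t : ℝ => boundaryLength p x (w + t • v) i)
      (∑ c, if p c = i then arcDeriv p x w v c else 0) 0 := by
    refine HasDerivAt.fun_sum fun c _ => ?_
    split_ifs
    · have hw' : w + (0 : ℝ) • v ∈ domain p x := by rwa [e]
      have := hasDerivAt_blackArc (hasDerivAt_redCosh (w := w) (x := x) v c)
        (hasDerivAt_redCosh (w := w) (x := x) v (c.1, c.2 + 1))
        (hasDerivAt_redCosh (w := w) (x := x) v (c.1, c.2 + 2))
        (one_lt_redCosh hw' _) (one_lt_redCosh hw' _) (one_lt_redCosh hw' _)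
      rw [e] at this
      refine this.congr_deriv ?_
      obtain ⟨f, k⟩ := c
      fin_cases k <;> rfl
    · exact hasDerivAt_const _ _
  exact (hasDerivAt_pi.1 h2 i).unique h4

/-- Regrouping the sum over boundary components by faces reduces symmetry and definiteness of the
Jacobian to one hexagon. -/
theorem fderiv_boundaryLength_dotProduct [DecidableEq β] (hw : w ∈ domain p x) (u v : β → ℝ) :
    fderiv ℝ (boundaryLength p x) w u ⬝ᵥ v =
      ∑ f : F, (arcDeriv p x w u (f, 0) * v (p (f, 0)) + arcDeriv p x w u (f, 1) * v (p (f, 1)) +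
        arcDeriv p x w u (f, 2) * v (p (f, 2))) := by
  simp only [dotProduct, fderiv_boundaryLength hw, Finset.sum_mul]
  rw [Finset.sum_comm]
  have : ∀ c : F × Fin 3, ∑ i, (if p c = i then arcDeriv p x w u c else 0) * v i =
      arcDeriv p x w u c * v (p c) := by
    intro c
    simp [ite_mul]
  simp only [this, Fintype.sum_prod_type, Fin.sum_univ_three]

theorem fderiv_boundaryLength_symm [DecidableEq β] (hw : w ∈ domain p x) (u v : β → ℝ) :
    fderiv ℝ (boundaryLength p x) w u ⬝ᵥ v = fderiv ℝ (boundaryLength p x) w v ⬝ᵥ u := by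
  rw [fderiv_boundaryLength_dotProduct hw, fderiv_boundaryLength_dotProduct hw]
  refine Finset.sum_congr rfl fun f _ => ?_
  exact blackArcDeriv_form_symm (one_lt_redCosh hw (f, 0)) (one_lt_redCosh hw (f, 1))
    (one_lt_redCosh hw (f, 2)) (u (p (f, 0))) (u (p (f, 1))) (u (p (f, 2))) (v (p (f, 0)))
    (v (p (f, 1))) (v (p (f, 2)))

theorem fderiv_boundaryLength_neg [DecidableEq β] (hp : Function.Surjective p)
    (hw : w ∈ domain p x) {v : β → ℝ} (hv : v ≠ 0) :
    fderiv ℝ (boundaryLength p x) w v ⬝ᵥ v < 0 := by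
  rw [fderiv_boundaryLength_dotProduct hw]
  obtain ⟨i, hi⟩ := Function.ne_iff.1 hv
  obtain ⟨⟨f, k⟩, rfl⟩ := hp i
  have key (f : F) (h : v (p (f, 0)) ≠ 0 ∨ v (p (f, 1)) ≠ 0 ∨ v (p (f, 2)) ≠ 0) :=
    blackArcDeriv_form_neg (one_lt_redCosh hw (f, 0)) (one_lt_redCosh hw (f, 1))
      (one_lt_redCosh hw (f, 2)) h
  refine Finset.sum_neg' (fun f _ => ?_) ⟨f, Finset.mem_univ f, ?_⟩
  · by_cases h : v (p (f, 0)) ≠ 0 ∨ v (p (f, 1)) ≠ 0 ∨ v (p (f, 2)) ≠ 0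
    · exact (key f h).le
    · push Not at h
      rw [h.1, h.2.1, h.2.2]
      simp
  · refine key f ?_
    fin_cases k
    exacts [Or.inl hi, Or.inr (Or.inl hi), Or.inr (Or.inr hi)]

end HexagonGluing

/-! ### Properness of the boundary lengths. -/

namespace HexagonGluing

variable {F β : Type*} [Fintype F] [DecidableEq β]

theorem exists_cosh_arc_le (p : F × Fin 3 → β) (x : F × Fin 3 → ℝ) (M : ℝ) :
    ∃ c, 1 < c ∧ ∀ w ∈ domain p x, (∀ i, boundaryLength p x w i ≤ M) →
      ∀ r, Real.cosh (arc p x w r) ≤ c := by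
  refine ⟨Real.cosh (|M| + 1), Real.one_lt_cosh.2 (by positivity), fun w hw h r => ?_⟩
  rw [Real.cosh_le_cosh, abs_of_pos (arc_pos hw r), abs_of_pos (by positivity)]
  linarith [arc_le_boundaryLength hw r, h (p r), le_abs_self M]

theorem exists_le_logCosh (p : F × Fin 3 → β) (x : F × Fin 3 → ℝ) (M : ℝ) :
    ∃ δ, 0 < δ ∧ ∀ w ∈ domain p x, (∀ i, boundaryLength p x w i ≤ M) →
      ∀ r, δ ≤ logCosh p x w r := by
  obtain ⟨c, hc, h⟩ := exists_cosh_arc_le p x M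
  have hc' : 0 < c ^ 2 - 1 := by nlinarith
  have hb : 1 < √(c ^ 2 / (c ^ 2 - 1)) := by
    rw [Real.lt_sqrt zero_le_one, one_pow, one_lt_div hc']
    linarith
  set b := √(c ^ 2 / (c ^ 2 - 1))
  refine ⟨Real.log ((b + 1) / 2) / 2, half_pos (Real.log_pos (by linarith)), fun w hw hM r => ?_⟩
  -- Seen from the black side `r.2 + 2`, the red side `r` is the adjacent one in position B, since
  -- `r.2 + 2 + 1 = r.2`.
  have h1 := sq_ge_of_cosh_blackArc_le (one_lt_redCosh hw _) (one_lt_redCosh hw _)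
    (one_lt_redCosh hw _) hc (h w hw hM (r.1, r.2 + 2))
  have e : r.2 + 2 + 1 = r.2 := by rw [add_assoc]; exact add_zero _
  simp only [e] at h1
  have h2 : b ≤ redCosh p x w r :=
    Real.sqrt_le_iff.2 ⟨(zero_lt_one.trans (one_lt_redCosh hw _)).le, h1⟩
  rw [redCosh] at h2
  have h3 : Real.log ((b + 1) / 2) ≤ 2 * logCosh p x w r :=
    (Real.log_le_iff_le_exp (by linarith)).2 (by linarith)
  linarith

theorem exists_abs_le (x : F × Fin 3 → ℝ) : ∃ X, 0 ≤ X ∧ ∀ r, |x r| ≤ X :=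
  ⟨∑ r, |x r|, Finset.sum_nonneg fun _ _ => abs_nonneg _, fun r =>
    Finset.single_le_sum (f := fun r => |x r|) (fun _ _ => abs_nonneg _) (Finset.mem_univ r)⟩

/-- Take logarithms in A ≤ c·BC, which holds when the black side is bounded, and isolate w_i by
`logCosh_add_sub`. -/
theorem exists_le_of_boundaryLength_le {p : F × Fin 3 → β} (hp : Function.Surjective p)
    (x : F × Fin 3 → ℝ) (M : ℝ) :
    ∃ C, ∀ w ∈ domain p x, (∀ i, boundaryLength p x w i ≤ M) → ∀ i, C ≤ w i := by
  obtain ⟨c, hc, h⟩ := exists_cosh_arc_le p x M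
  obtain ⟨X, -, hX⟩ := exists_abs_le x
  refine ⟨-(Real.log (4 * c) / 2 + 3 * X) / 2, fun w hw hM i => ?_⟩
  obtain ⟨r, rfl⟩ := hp i
  have h1 := le_mul_of_cosh_blackArc_le (one_lt_redCosh hw _) (one_lt_redCosh hw _)
    (one_lt_redCosh hw _) hc (h w hw hM r)
  have h2 : Real.exp (2 * logCosh p x w r) ≤ 4 * c *
      Real.exp (2 * logCosh p x w (r.1, r.2 + 1) + 2 * logCosh p x w (r.1, r.2 + 2)) := by
    have a0 := one_lt_redCosh hw r
    have a1 := one_lt_redCosh hw (r.1, r.2 + 1)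
    have a2 := one_lt_redCosh hw (r.1, r.2 + 2)
    rw [Real.exp_add]
    simp only [redCosh] at *
    have b1 := Real.exp_pos (2 * logCosh p x w (r.1, r.2 + 1))
    have b2 := Real.exp_pos (2 * logCosh p x w (r.1, r.2 + 2))
    generalize Real.exp (2 * logCosh p x w (r.1, r.2 + 1)) = u at *
    generalize Real.exp (2 * logCosh p x w (r.1, r.2 + 2)) = v at *
    have : (2 * u - 1) * (2 * v - 1) ≤ 4 * (u * v) := by nlinarith
    nlinarith [mul_le_mul_of_nonneg_left this (zero_le_one.trans hc.le)]
  rw [← Real.log_le_log_iff (Real.exp_pos _) (by positivity), Real.log_exp,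
    Real.log_mul (by positivity) (Real.exp_pos _).ne', Real.log_exp] at h2
  have h3 := logCosh_add_sub (p := p) (x := x) (w := w) r
  have x0 := abs_le.1 (hX r)
  have x1 := abs_le.1 (hX (r.1, r.2 + 1))
  have x2 := abs_le.1 (hX (r.1, r.2 + 2))
  linarith

/-- Some black side at i is at least m/(N + 1) long. The other factors being bounded below, a large
w_i makes both adjacent red sides long and A/(BC) small, and the black side would be short. The role
of ε is played by `L * exp (-4 w_i)`. -/
theorem exists_le_of_le_boundaryLength {p : F × Fin 3 → β} (hp : Function.Surjective p)
    (x : F × Fin 3 → ℝ) {m : ℝ} (hm : 0 < m) (M : ℝ) :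
    ∃ R, ∀ w ∈ domain p x, (∀ i, boundaryLength p x w i ≤ M) →
      ∀ i, m ≤ boundaryLength p x w i → w i ≤ R := by
  obtain ⟨C, hC⟩ := exists_le_of_boundaryLength_le hp x M
  obtain ⟨X, hX0, hX⟩ := exists_abs_le x
  set N : ℝ := ((Fintype.card (F × Fin 3) : ℕ) : ℝ)
  set c := Real.cosh (m / (N + 1))
  have hN : 0 ≤ N := Nat.cast_nonneg _
  have hc : 1 < c := Real.one_lt_cosh.2 (by positivity)
  set L := 2 * Real.exp (6 * X + 4 * |C|)
  refine ⟨-Real.log ((c - 1) / (L * (c + 1))) / 4, fun w hw hM i hi => ?_⟩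
  have hc1 : 0 < c - 1 := by linarith
  obtain ⟨r, rfl, hr⟩ : ∃ r, p r = i ∧ m / (N + 1) ≤ arc p x w r := by
    by_contra! hcon
    have : boundaryLength p x w i ≤ ∑ r : F × Fin 3, m / (N + 1) := by
      refine Finset.sum_le_sum fun r _ => ?_
      split_ifs with h
      exacts [(hcon r h).le, by positivity]
    rw [Finset.sum_const, Finset.card_univ, nsmul_eq_mul] at this
    have h2 : N * (m / (N + 1)) < m := by
      rw [← mul_div_assoc, div_lt_iff₀ (by positivity)]
      nlinarith
    linarith
  have hcr : c ≤ Real.cosh (arc p x w r) := by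
    rw [Real.cosh_le_cosh, abs_of_pos (by positivity), abs_of_pos (arc_pos hw r)]
    exact hr
  have x0 := abs_le.1 (hX r)
  have x1 := abs_le.1 (hX (r.1, r.2 + 1))
  have x2 := abs_le.1 (hX (r.1, r.2 + 2))
  have c1 := hC w hw hM (p (r.1, r.2 + 1))
  have c2 := hC w hw hM (p (r.1, r.2 + 2))
  have hCC := neg_abs_le C
  have h3 := logCosh_add_sub (p := p) (x := x) (w := w) r
  -- The red sides `r.2 + 1` and `r.2 + 2` are those with an end on the black side `r`.
  have g1 : w (p r) - X - |C| ≤ logCosh p x w (r.1, r.2 + 1) := by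
    obtain ⟨f, k⟩ := r
    fin_cases k <;> simp [logCosh] at * <;> linarith
  have g2 : w (p r) - X - |C| ≤ logCosh p x w (r.1, r.2 + 2) := by
    obtain ⟨f, k⟩ := r
    fin_cases k <;> simp [logCosh] at * <;> linarith
  have hexp : ∀ s, Real.exp (2 * logCosh p x w s) ≤ redCosh p x w s := by
    intro s
    have := one_lt_redCosh hw s
    rw [redCosh] at *
    linarith
  have hsq : ∀ s, w (p r) - X - |C| ≤ logCosh p x w s →
      1 ≤ L * Real.exp (-4 * w (p r)) * redCosh p x w s ^ 2 := by
    intro s hs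
    calc (1 : ℝ) ≤ 2 * Real.exp (6 * X + 4 * |C| - 4 * w (p r) + 4 * logCosh p x w s) := by
          have : 1 ≤ Real.exp (6 * X + 4 * |C| - 4 * w (p r) + 4 * logCosh p x w s) :=
            Real.one_le_exp (by linarith)
          linarith
      _ = L * Real.exp (-4 * w (p r)) * Real.exp (2 * logCosh p x w s) ^ 2 := by
          simp only [L]
          rw [← Real.exp_nat_mul, mul_assoc, mul_assoc, ← Real.exp_add, ← Real.exp_add]
          congr 2
          push_cast
          ring
      _ ≤ _ := by
          have : 0 ≤ L * Real.exp (-4 * w (p r)) := by positivity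
          gcongr
          exact hexp s
  have hlin : redCosh p x w r ≤ L * Real.exp (-4 * w (p r)) *
      (redCosh p x w (r.1, r.2 + 1) * redCosh p x w (r.1, r.2 + 2)) := by
    calc redCosh p x w r ≤ 2 * Real.exp (2 * logCosh p x w r) := by rw [redCosh]; linarith
      _ ≤ 2 * Real.exp (6 * X + 4 * |C| - 4 * w (p r) + (2 * logCosh p x w (r.1, r.2 + 1) +
            2 * logCosh p x w (r.1, r.2 + 2))) := by
          gcongr
          have := abs_nonneg C
          linarith
      _ = L * Real.exp (-4 * w (p r)) * (Real.exp (2 * logCosh p x w (r.1, r.2 + 1)) *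
            Real.exp (2 * logCosh p x w (r.1, r.2 + 2))) := by
          simp only [L]
          rw [← Real.exp_add, mul_assoc, mul_assoc, ← Real.exp_add, ← Real.exp_add]
          congr 2
          ring
      _ ≤ _ := by
          have : 0 ≤ L * Real.exp (-4 * w (p r)) := by positivity
          gcongr
          · exact (zero_lt_one.trans (one_lt_redCosh hw _)).le
          · exact hexp _
          · exact hexp _
  have key := sub_one_le_of_le_cosh_blackArc (one_lt_redCosh hw _) (one_lt_redCosh hw _)
    (one_lt_redCosh hw _) hc hcr hlin (hsq _ g1) (hsq _ g2)
  have h4 : (c - 1) / (L * (c + 1)) ≤ Real.exp (-4 * w (p r)) := by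
    rw [div_le_iff₀ (by positivity)]
    linarith
  rw [← Real.log_le_iff_le_exp (by positivity)] at h4
  linarith

theorem exists_isCompact_of_boundaryLength_le [Fintype β] {p : F × Fin 3 → β}
    (hp : Function.Surjective p) (x : F × Fin 3 → ℝ) (M R : ℝ) :
    ∃ Q ⊆ domain p x, IsCompact Q ∧ ∀ w ∈ domain p x, (∀ i, boundaryLength p x w i ≤ M) →
      (∀ i, w i ≤ R) → w ∈ Q := by
  obtain ⟨C, hC⟩ := exists_le_of_boundaryLength_le hp x M
  obtain ⟨δ, hδ, h⟩ := exists_le_logCosh p x M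
  refine ⟨Set.Icc (fun _ => C) (fun _ => R) ∩ ⋂ r, {w | δ ≤ logCosh p x w r},
    fun w hw r => hδ.trans_le (Set.mem_iInter.1 hw.2 r),
    isCompact_Icc.inter_right
      (isClosed_iInter fun r => isClosed_le continuous_const (continuous_logCosh r)),
    fun w hw hM hR => ⟨⟨hC w hw hM, hR⟩, Set.mem_iInter.2 (h w hw hM)⟩⟩

end HexagonGluing

/-! ### Global solutions of Lipschitz differential equations. -/

section ODE

variable {E : Type*} [NormedAddCommGroup E] [NormedSpace ℝ E]

/-- A bounded Lipschitz vector field has solutions on arbitrarily long intervals. -/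
theorem exists_hasDerivWithinAt_Icc_of_lipschitzWith [CompleteSpace E] {X : E → E} {C : NNReal}
    (hX : LipschitzWith C X) {L : ℝ} (hL : ∀ x, ‖X x‖ ≤ L) (x₀ : E) {T : ℝ} (hT : 0 ≤ T) :
    ∃ α : ℝ → E, α 0 = x₀ ∧
      ∀ t ∈ Set.Icc 0 T, HasDerivWithinAt α (X (α t)) (Set.Icc 0 T) t := by
  have hL0 : 0 ≤ L := (norm_nonneg _).trans (hL x₀)
  have hpl : IsPicardLindelof (fun _ => X) (tmin := 0) (tmax := T) ⟨0, le_rfl, hT⟩ x₀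
      (⟨L * T, by positivity⟩ : NNReal) 0 ⟨L, hL0⟩ C :=
    IsPicardLindelof.of_time_independent (fun x _ => hL x) hX.lipschitzOnWith (by
      simp only [sub_zero, sub_self, NNReal.coe_zero, max_eq_left hT]; exact le_rfl)
  exact hpl.exists_eq_forall_mem_Icc_hasDerivWithinAt₀

theorem HasDerivWithinAt.Ici_of_Icc {f : ℝ → E} {f' : E} {b t : ℝ}
    (hf : HasDerivWithinAt f f' (Set.Icc 0 b) t) (h0 : 0 ≤ t) (hb : t < b) :
    HasDerivWithinAt f f' (Set.Ici t) t :=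
  (hf.mono (Set.Icc_subset_Icc_left h0)).mono_of_mem_nhdsWithin (Icc_mem_nhdsGE hb)

theorem exists_hasDerivWithinAt_Ici_of_lipschitzWith [CompleteSpace E] {X : E → E} {C : NNReal}
    (hX : LipschitzWith C X) {L : ℝ} (hL : ∀ x, ‖X x‖ ≤ L) (x₀ : E) :
    ∃ α : ℝ → E, α 0 = x₀ ∧
      ∀ t ∈ Set.Ici (0 : ℝ), HasDerivWithinAt α (X (α t)) (Set.Ici 0) t := by
  choose α hα0 hα using fun n : ℕ => exists_hasDerivWithinAt_Icc_of_lipschitzWith hX hL x₀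
    (T := (n : ℝ) + 1) (by positivity)
  have hagree : ∀ m n : ℕ, m ≤ n → Set.EqOn (α m) (α n) (Set.Icc 0 ((m : ℝ) + 1)) := by
    intro m n hmn
    have hmn' : (m : ℝ) + 1 ≤ (n : ℝ) + 1 := by gcongr
    refine ODE_solution_unique (v := fun _ => X) (fun _ => hX)
      (fun t ht => (hα m t ht).continuousWithinAt)
      (fun t ht => (hα m t ⟨ht.1, ht.2.le⟩).Ici_of_Icc ht.1 ht.2)
      (fun t ht => ((hα n t ⟨ht.1, ht.2.trans hmn'⟩).continuousWithinAt).mono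
        (Set.Icc_subset_Icc_right hmn'))
      (fun t ht => (hα n t ⟨ht.1, ht.2.le.trans hmn'⟩).Ici_of_Icc ht.1 (ht.2.trans_le hmn'))
      (by rw [hα0, hα0])
  -- The solution with index ⌊t⌋ lives up to ⌊t⌋ + 1 > t, hence on a neighbourhood of t in [0, ∞).
  refine ⟨fun t => α ⌊t⌋₊ t, by simp [hα0], fun t ht => ?_⟩
  have ht' : t < (⌊t⌋₊ : ℝ) + 1 := Nat.lt_floor_add_one t
  have h1 : HasDerivWithinAt (α ⌊t⌋₊) (X (α ⌊t⌋₊ t)) (Set.Ici 0) t :=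
    (hα ⌊t⌋₊ t ⟨ht, ht'.le⟩).mono_of_mem_nhdsWithin (by
      rw [← Set.Ici_inter_Iic]
      exact Filter.inter_mem self_mem_nhdsWithin (mem_nhdsWithin_of_mem_nhds (Iic_mem_nhds ht')))
  refine h1.congr_of_eventuallyEq ?_ rfl
  filter_upwards [self_mem_nhdsWithin, mem_nhdsWithin_of_mem_nhds (Iio_mem_nhds ht')] with s hs hs'
  refine hagree _ _ ?_ ⟨hs, (Nat.lt_floor_add_one s).le⟩
  have : (⌊s⌋₊ : ℝ) < ⌊t⌋₊ + 1 := (Nat.floor_le hs).trans_lt hs'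
  exact Nat.lt_succ_iff.1 (by exact_mod_cast this)

/-- A solution that starts where the vector field does not vanish never reaches a zero. -/
theorem ne_zero_of_hasDerivWithinAt_Ici {X : E → E} {C : NNReal} (hX : LipschitzWith C X)
    {α : ℝ → E} (hα : ∀ t ∈ Set.Ici (0 : ℝ), HasDerivWithinAt α (X (α t)) (Set.Ici 0) t)
    (h0 : X (α 0) ≠ 0) {t : ℝ} (ht : 0 ≤ t) : X (α t) ≠ 0 := by
  intro hzero
  have h := ODE_solution_unique_of_mem_Icc_left (v := fun _ => X) (s := fun _ => Set.univ)
    (K := C) (a := 0) (b := t) (f := α) (g := fun _ => α t) (fun _ _ => hX.lipschitzOnWith)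
    (fun s hs => (hα s hs.1).continuousWithinAt.mono Set.Icc_subset_Ici_self)
    (fun s hs => ((hα s hs.1.le).hasDerivAt (Ici_mem_nhds hs.1)).hasDerivWithinAt)
    (fun _ _ => trivial) continuousOn_const
    (fun s _ => by simpa only [hzero] using hasDerivWithinAt_const s _ (α t))
    (fun _ _ => trivial) rfl ⟨le_rfl, ht⟩
  rw [h] at h0
  exact h0 hzero

end ODE

/-! ### Cutting off a vector field. -/

section Cutoff

variable {E G : Type*} [NormedAddCommGroup E] [NormedSpace ℝ E] [NormedAddCommGroup G]
  [NormedSpace ℝ G]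

theorem exists_contDiff_cutoff [FiniteDimensional ℝ E] {Q W : Set E} (hQ : IsCompact Q)
    (hW : IsOpen W) (hQW : Q ⊆ W) :
    ∃ χ : E → ℝ, ContDiff ℝ 1 χ ∧ HasCompactSupport χ ∧ tsupport χ ⊆ W ∧ (∀ x ∈ Q, χ x = 1) ∧
      ∀ x, 0 ≤ χ x := by
  obtain ⟨L, hL, hQL, hLW⟩ := exists_compact_between hQ hW hQW
  obtain ⟨f, h1, h0, h⟩ := exists_contMDiffMap_one_nhds_of_subset_interior (n := 1)
    (modelWithCornersSelf ℝ E) hQ.isClosed hQL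
  have hsupp : tsupport f ⊆ L := closure_minimal
    (fun x hx => by by_contra hxL; exact hx (h0 x hxL)) hL.isClosed
  exact ⟨f, f.contMDiff.contDiff, hL.of_isClosed_subset (isClosed_tsupport _) hsupp,
    hsupp.trans hLW, fun x hx => h1.self_of_nhdsSet x hx, fun x => (h x).1⟩

theorem contDiff_smul_of_tsupport_subset {W : Set E} {χ : E → ℝ} {V : E → G} (hχ : ContDiff ℝ 1 χ)
    (hW : tsupport χ ⊆ W) (hV : ∀ x ∈ W, ContDiffAt ℝ 1 V x) :
    ContDiff ℝ 1 fun x => χ x • V x := by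
  refine contDiff_iff_contDiffAt.2 fun x => ?_
  by_cases hx : x ∈ tsupport χ
  · exact hχ.contDiffAt.smul (hV x (hW hx))
  · have : (fun x => χ x • V x) =ᶠ[nhds x] fun _ => 0 := by
      filter_upwards [(isClosed_tsupport χ).isOpen_compl.mem_nhds hx] with y hy
      rw [image_eq_zero_of_notMem_tsupport hy, zero_smul]
    exact contDiffAt_const.congr_of_eventuallyEq this

end Cutoff

/-! ### Curvature maps: bijectivity and the convex potential. -/

section

variable {ι : Type*} [Fintype ι]

/-- The dot product as a bounded bilinear map. -/
noncomputable def dotL (ι : Type*) [Fintype ι] : (ι → ℝ) →L[ℝ] (ι → ℝ) →L[ℝ] ℝ :=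
  ∑ i, (ContinuousLinearMap.proj (R := ℝ) (φ := fun _ : ι => ℝ) i).smulRight
    (ContinuousLinearMap.proj (R := ℝ) (φ := fun _ : ι => ℝ) i)

theorem dotL_apply (u v : ι → ℝ) : dotL ι u v = u ⬝ᵥ v := by
  simp [dotL, dotProduct]

theorem dotProduct_self_nonneg' (u : ι → ℝ) : 0 ≤ u ⬝ᵥ u :=
  Finset.sum_nonneg fun i _ => mul_self_nonneg (u i)

theorem dotProduct_sq_le (u v : ι → ℝ) : (u ⬝ᵥ v) ^ 2 ≤ (u ⬝ᵥ u) * (v ⬝ᵥ v) := by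
  have := Finset.sum_mul_sq_le_sq_mul_sq Finset.univ u v
  simpa only [dotProduct, sq] using this

theorem norm_sq_le_dotProduct (u : ι → ℝ) : ‖u‖ ^ 2 ≤ u ⬝ᵥ u := by
  have h := dotProduct_self_nonneg' u
  have : ‖u‖ ≤ √(u ⬝ᵥ u) := by
    refine (pi_norm_le_iff_of_nonneg (Real.sqrt_nonneg _)).2 fun i => ?_
    rw [Real.norm_eq_abs]
    refine Real.abs_le_sqrt ?_
    rw [sq]
    exact Finset.single_le_sum (f := fun i => u i * u i) (fun i _ => mul_self_nonneg (u i))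
      (Finset.mem_univ i)
  calc ‖u‖ ^ 2 ≤ √(u ⬝ᵥ u) ^ 2 := pow_le_pow_left₀ (norm_nonneg _) this 2
    _ = u ⬝ᵥ u := Real.sq_sqrt h

/-- A curvature map: it is twice continuously differentiable on an open convex set, with symmetric
negative definite Jacobian, and proper as a map to the positive orthant. -/
structure IsCurvatureMap (W : Set (ι → ℝ)) (k : (ι → ℝ) → ι → ℝ) : Prop where
  isOpen : IsOpen W
  convex : Convex ℝ W
  nonempty : W.Nonempty
  contDiffAt : ∀ w ∈ W, ContDiffAt ℝ 2 k w
  symm : ∀ w ∈ W, ∀ u v, fderiv ℝ k w u ⬝ᵥ v = fderiv ℝ k w v ⬝ᵥ u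
  neg : ∀ w ∈ W, ∀ v ≠ 0, fderiv ℝ k w v ⬝ᵥ v < 0
  pos : ∀ w ∈ W, ∀ i, 0 < k w i
  exists_isCompact : ∀ M R, ∃ Q ⊆ W, IsCompact Q ∧
    ∀ w ∈ W, (∀ i, k w i ≤ M) → (∀ i, w i ≤ R) → w ∈ Q
  exists_le : ∀ m, 0 < m → ∀ M, ∃ R, ∀ w ∈ W, (∀ i, k w i ≤ M) → ∀ i, m ≤ k w i → w i ≤ R

namespace IsCurvatureMap

variable {W : Set (ι → ℝ)} {k : (ι → ℝ) → ι → ℝ}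

theorem hasFDerivAt (h : IsCurvatureMap W k) {w : ι → ℝ} (hw : w ∈ W) :
    HasFDerivAt k (fderiv ℝ k w) w :=
  ((h.contDiffAt w hw).differentiableAt two_ne_zero).hasFDerivAt

theorem contDiffAt_fderiv (h : IsCurvatureMap W k) {w : ι → ℝ} (hw : w ∈ W) :
    ContDiffAt ℝ 1 (fderiv ℝ k) w :=
  (h.contDiffAt w hw).fderiv_right (by norm_num [one_add_one_eq_two])

theorem continuousOn (h : IsCurvatureMap W k) : ContinuousOn k W := fun w hw =>
  (h.contDiffAt w hw).continuousAt.continuousWithinAt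

theorem exists_sub_dotProduct_eq (h : IsCurvatureMap W k) {u v : ι → ℝ} (hu : u ∈ W) (hv : v ∈ W)
    (d : ι → ℝ) :
    ∃ z ∈ segment ℝ u v, (k v - k u) ⬝ᵥ d = fderiv ℝ k z (v - u) ⬝ᵥ d := by
  have hf : ∀ w ∈ W, HasFDerivWithinAt (fun w => dotL ι d (k w))
      ((dotL ι d).comp (fderiv ℝ k w)) W w := fun w hw =>
    ((dotL ι d).hasFDerivAt.comp w (h.hasFDerivAt hw)).hasFDerivWithinAt
  obtain ⟨z, hz, he⟩ := domain_mvt hf h.convex hu hv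
  refine ⟨z, hz, ?_⟩
  simp only [ContinuousLinearMap.comp_apply, dotL_apply] at he
  rw [dotProduct_comm, dotProduct_sub, he, dotProduct_comm]

theorem sub_dotProduct_neg (h : IsCurvatureMap W k) {u v : ι → ℝ} (hu : u ∈ W) (hv : v ∈ W)
    (huv : u ≠ v) : (k v - k u) ⬝ᵥ (v - u) < 0 := by
  obtain ⟨z, hz, he⟩ := h.exists_sub_dotProduct_eq hu hv (v - u)
  rw [he]
  exact h.neg z (h.convex.segment_subset hu hv hz) _ (sub_ne_zero.2 huv.symm)

theorem injOn (h : IsCurvatureMap W k) : Set.InjOn k W := by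
  intro u hu v hv huv
  by_contra hne
  have := h.sub_dotProduct_neg hu hv hne
  rw [huv, sub_self, zero_dotProduct] at this
  exact this.false

theorem range_fderiv (h : IsCurvatureMap W k) {w : ι → ℝ} (hw : w ∈ W) :
    (fderiv ℝ k w).range = ⊤ := by
  have hinj : Function.Injective (fderiv ℝ k w).toLinearMap := by
    refine (injective_iff_map_eq_zero _).2 fun v hv => ?_
    by_contra hne
    have := h.neg w hw v hne
    rw [show fderiv ℝ k w v = 0 from hv, zero_dotProduct] at this
    exact this.false
  exact LinearMap.range_eq_top.2 (LinearMap.injective_iff_surjective.1 hinj)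

theorem isOpen_image (h : IsCurvatureMap W k) : IsOpen (k '' W) := by
  refine isOpen_iff_mem_nhds.2 ?_
  rintro _ ⟨w, hw, rfl⟩
  rw [← ((h.contDiffAt w hw).hasStrictFDerivAt two_ne_zero).map_nhds_eq_of_surj
    (h.range_fderiv hw)]
  exact Filter.image_mem_map (h.isOpen.mem_nhds hw)

theorem exists_isCompact_of_le_of_le (h : IsCurvatureMap W k) {m : ι → ℝ} (hm : ∀ i, 0 < m i)
    (M : ℝ) : ∃ Q ⊆ W, IsCompact Q ∧
      ∀ w ∈ W, (∀ i, m i ≤ k w i) → (∀ i, k w i ≤ M) → w ∈ Q := by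
  choose R hR using fun i => h.exists_le (m i) (hm i) M
  obtain ⟨Q, hQW, hQ, hQ'⟩ := h.exists_isCompact M (∑ i, |R i|)
  refine ⟨Q, hQW, hQ, fun w hw h1 h2 => hQ' w hw h2 fun i => ?_⟩
  exact (hR i w hw h2 i (h1 i)).trans ((le_abs_self _).trans
    (Finset.single_le_sum (f := fun i => |R i|) (fun _ _ => abs_nonneg _) (Finset.mem_univ i)))

/-- The image is open, and relatively closed in the orthant: near a positive κ all values lie
between κ/2 and a fixed bound, so their preimages stay in one compact subset of W. The orthant is
connected. -/
theorem image_eq (h : IsCurvatureMap W k) : k '' W = {κ | ∀ i, 0 < κ i} := by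
  refine Set.Subset.antisymm ?_ ?_
  · rintro _ ⟨w, hw, rfl⟩
    exact h.pos w hw
  have hconv : Convex ℝ {κ : ι → ℝ | ∀ i, 0 < κ i} := by
    have : {κ : ι → ℝ | ∀ i, 0 < κ i} = Set.pi Set.univ fun _ => Set.Ioi (0 : ℝ) := by
      ext; simp
    rw [this]
    exact convex_pi fun i _ => convex_Ioi 0
  refine hconv.isPreconnected.subset_of_closure_inter_subset h.isOpen_image ?_ ?_
  · obtain ⟨w, hw⟩ := h.nonempty
    exact ⟨k w, h.pos w hw, w, hw, rfl⟩
  rintro κ ⟨hκ, hpos⟩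
  obtain ⟨Q, hQW, hQ, hQ'⟩ := h.exists_isCompact_of_le_of_le (m := fun i => κ i / 2)
    (fun i => half_pos (hpos i)) (∑ i, |κ i| + 1)
  have hN : {κ' : ι → ℝ | ∀ i, κ i / 2 < κ' i ∧ κ' i < κ i + 1} ∈ nhds κ := by
    refine IsOpen.mem_nhds ?_ fun i => ⟨half_lt_self (hpos i), lt_add_one _⟩
    have : {κ' : ι → ℝ | ∀ i, κ i / 2 < κ' i ∧ κ' i < κ i + 1} =
        Set.pi Set.univ fun i => Set.Ioo (κ i / 2) (κ i + 1) := by ext; simp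
    rw [this]
    exact isOpen_set_pi Set.finite_univ fun i _ => isOpen_Ioo
  have h1 : κ ∈ closure (k '' Q) := by
    refine mem_closure_iff_nhds.2 fun t ht => ?_
    obtain ⟨_, ⟨h2, h3⟩, w, hw, rfl⟩ := mem_closure_iff_nhds.1 hκ _ (Filter.inter_mem ht hN)
    refine ⟨k w, h2, w, hQ' w hw (fun i => (h3 i).1.le) fun i => (h3 i).2.le.trans ?_, rfl⟩
    gcongr
    exact (le_abs_self _).trans (Finset.single_le_sum (f := fun i => |κ i|)
      (fun _ _ => abs_nonneg _) (Finset.mem_univ i))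
  rw [(hQ.image_of_continuousOn (h.continuousOn.mono hQW)).isClosed.closure_eq] at h1
  exact Set.image_mono hQW h1

/-- The form attains its maximum on the compact product of Q with the unit sphere, and that maximum
is negative; homogeneity does the rest. -/
theorem exists_fderiv_dotProduct_le (h : IsCurvatureMap W k) {Q : Set (ι → ℝ)} (hQ : IsCompact Q)
    (hQW : Q ⊆ W) : ∃ c, 0 < c ∧ ∀ w ∈ Q, ∀ v, fderiv ℝ k w v ⬝ᵥ v ≤ -(c * (v ⬝ᵥ v)) := by
  have hS : IsCompact {v : ι → ℝ | v ⬝ᵥ v = 1} := by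
    refine Metric.isCompact_of_isClosed_isBounded
      (isClosed_eq (by unfold dotProduct; fun_prop) continuous_const) ?_
    refine (Metric.isBounded_iff_subset_closedBall 0).2 ⟨1, fun v hv => ?_⟩
    rw [mem_closedBall_zero_iff]
    have := norm_sq_le_dotProduct v
    rw [show v ⬝ᵥ v = 1 from hv] at this
    exact (sq_le_one_iff₀ (norm_nonneg v)).1 this
  have hcont : ContinuousOn (fun q : (ι → ℝ) × (ι → ℝ) => dotL ι q.2 (fderiv ℝ k q.1 q.2))
      (Q ×ˢ {v | v ⬝ᵥ v = 1}) := by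
    have h1 : ContinuousOn (fun q : (ι → ℝ) × (ι → ℝ) => fderiv ℝ k q.1)
        (Q ×ˢ {v | v ⬝ᵥ v = 1}) := fun q hq =>
      ((h.contDiffAt_fderiv (hQW hq.1)).continuousAt.comp
        continuous_fst.continuousAt).continuousWithinAt
    exact ((dotL ι).continuous.comp_continuousOn continuousOn_snd).clm_apply
      (h1.clm_apply continuousOn_snd)
  obtain ⟨c, hc, hle⟩ : ∃ c, 0 < c ∧ ∀ w ∈ Q, ∀ v : ι → ℝ, v ⬝ᵥ v = 1 →
      fderiv ℝ k w v ⬝ᵥ v ≤ -c := by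
    rcases (Q ×ˢ {v : ι → ℝ | v ⬝ᵥ v = 1}).eq_empty_or_nonempty with he | hne
    · refine ⟨1, one_pos, fun w hw v hv => ?_⟩
      exact absurd (show (w, v) ∈ Q ×ˢ {v : ι → ℝ | v ⬝ᵥ v = 1} from ⟨hw, hv⟩) (by simp [he])
    · obtain ⟨⟨w₀, v₀⟩, ⟨hw₀, hv₀⟩, hmax⟩ := (hQ.prod hS).exists_isMaxOn hne hcont
      have hv₀' : v₀ ≠ 0 := by
        rintro rfl
        simp at hv₀
      refine ⟨-(fderiv ℝ k w₀ v₀ ⬝ᵥ v₀), neg_pos.2 (h.neg w₀ (hQW hw₀) v₀ hv₀'),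
        fun w hw v hv => ?_⟩
      have := hmax (show (w, v) ∈ Q ×ˢ {v : ι → ℝ | v ⬝ᵥ v = 1} from ⟨hw, hv⟩)
      simp only [Set.mem_ofPred_eq, dotL_apply] at this
      rwa [neg_neg, dotProduct_comm, dotProduct_comm _ v₀]
  refine ⟨c, hc, fun w hw v => ?_⟩
  rcases (dotProduct_self_nonneg' v).eq_or_lt with h0 | h0
  · have : v = 0 := dotProduct_self_eq_zero.1 h0.symm
    subst this
    simp
  · have hs : 0 < √(v ⬝ᵥ v) := Real.sqrt_pos.2 h0
    have hss := Real.mul_self_sqrt h0.le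
    have := hle w hw ((√(v ⬝ᵥ v))⁻¹ • v) (by
      rw [smul_dotProduct, dotProduct_smul, smul_eq_mul, smul_eq_mul]
      field_simp
      rw [sq, hss])
    rw [map_smul, smul_dotProduct, dotProduct_smul, smul_eq_mul, smul_eq_mul] at this
    field_simp at this
    rw [sq, hss] at this
    linarith

theorem exists_sub_dotProduct_le (h : IsCurvatureMap W k) {Q : Set (ι → ℝ)} (hQ : IsCompact Q)
    (hQW : Q ⊆ W) {u : ι → ℝ} (hu : u ∈ W) : ∃ c, 0 < c ∧ ∀ v ∈ Q,
      (k v - k u) ⬝ᵥ (v - u) ≤ -(c * ((v - u) ⬝ᵥ (v - u))) := by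
  -- Q need not be convex, so the mean value argument needs uniform definiteness on the union of all
  -- segments from u to Q. It is compact, and it lies in W by convexity.
  have hS : IsCompact ((fun q : ℝ × (ι → ℝ) => u + q.1 • (q.2 - u)) '' Set.Icc 0 1 ×ˢ Q) :=
    (isCompact_Icc.prod hQ).image (by fun_prop)
  have hSv : ∀ v ∈ Q, segment ℝ u v ⊆
      (fun q : ℝ × (ι → ℝ) => u + q.1 • (q.2 - u)) '' Set.Icc 0 1 ×ˢ Q := by
    intro v hv z hz
    obtain ⟨t, ht, rfl⟩ := (segment_eq_image' ℝ u v).subset hz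
    exact ⟨(t, v), ⟨ht, hv⟩, rfl⟩
  obtain ⟨c, hc, hle⟩ := h.exists_fderiv_dotProduct_le hS (by
    rintro _ ⟨⟨t, v⟩, ⟨ht, hv⟩, rfl⟩
    exact h.convex.add_smul_sub_mem hu (hQW hv) ht)
  refine ⟨c, hc, fun v hv => ?_⟩
  obtain ⟨z, hz, he⟩ := h.exists_sub_dotProduct_eq hu (hQW hv) (v - u)
  rw [he]
  exact hle z (hSv v hv hz) _

/-- The Poincaré lemma on a convex set: the 1-form κ - k is closed because the Jacobian is
symmetric. -/
theorem exists_potential (h : IsCurvatureMap W k) (κ : ι → ℝ) :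
    ∃ H : (ι → ℝ) → ℝ, ∀ w ∈ W, HasFDerivAt H (dotL ι (κ - k w)) w := by
  have hd : ∀ w ∈ W, HasFDerivAt (fun w => dotL ι (κ - k w)) ((dotL ι).comp (-fderiv ℝ k w)) w :=
    fun w hw => (dotL ι).hasFDerivAt.comp w ((h.hasFDerivAt hw).const_sub κ)
  refine h.convex.exists_forall_hasFDerivAt_of_fderiv_symmetric h.isOpen
    (fun w hw => (hd w hw).differentiableAt.differentiableWithinAt) fun w hw u v => ?_
  rw [(hd w hw).fderiv]
  simp only [ContinuousLinearMap.comp_apply, neg_apply, map_neg, dotL_apply,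
    h.symm w hw u v]

/-- H is convex, its gradient κ - k being monotone, so its graph lies above its tangent planes. -/
theorem potential_gradient_le (h : IsCurvatureMap W k) {κ : ι → ℝ} {H : (ι → ℝ) → ℝ}
    (hH : ∀ w ∈ W, HasFDerivAt H (dotL ι (κ - k w)) w) {u w : ι → ℝ} (hu : u ∈ W) (hw : w ∈ W) :
    (κ - k u) ⬝ᵥ (w - u) ≤ H w - H u := by
  obtain ⟨z, hz, he⟩ := domain_mvt (fun w hw => (hH w hw).hasFDerivWithinAt) h.convex hu hw
  rw [dotL_apply] at he
  rw [he]
  have hzW := h.convex.segment_subset hu hw hz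
  obtain ⟨t, ⟨ht0, ht1⟩, rfl⟩ := (segment_eq_image' ℝ u w).subset hz
  simp only at *
  set z := u + t • (w - u)
  suffices 0 ≤ (k u - k z) ⬝ᵥ (w - u) by
    have e : (κ - k z) ⬝ᵥ (w - u) = (κ - k u) ⬝ᵥ (w - u) + (k u - k z) ⬝ᵥ (w - u) := by
      rw [← add_dotProduct]; congr 1; abel
    linarith
  by_cases hzu : u = z
  · rw [← hzu, sub_self, zero_dotProduct]
  · have := h.sub_dotProduct_neg hu hzW hzu
    have e : z - u = t • (w - u) := by simp [z]
    rw [e, dotProduct_smul, smul_eq_mul] at this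
    have e2 : (k u - k z) ⬝ᵥ (w - u) = -((k z - k u) ⬝ᵥ (w - u)) := by
      rw [← neg_dotProduct, neg_sub]
    rw [e2]
    by_contra hcon
    nlinarith

/-- Uniform definiteness on a ball of radius r about the minimum gives H a definite outward slope on
the sphere. By convexity H grows at least like (d - r)·c·r at distance d > r, which yields the
radius below. -/
theorem exists_norm_sub_le_of_potential_le (h : IsCurvatureMap W k) {κ wbar : ι → ℝ}
    (hwbar : wbar ∈ W) (hκ : k wbar = κ) {H : (ι → ℝ) → ℝ}
    (hH : ∀ w ∈ W, HasFDerivAt H (dotL ι (κ - k w)) w) (η : ℝ) :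
    ∃ R, ∀ w ∈ W, H w ≤ η → ‖w - wbar‖ ≤ R := by
  obtain ⟨r, hr, hrW⟩ := Metric.nhds_basis_closedBall.mem_iff.1 (h.isOpen.mem_nhds hwbar)
  obtain ⟨c, hc, hle⟩ := h.exists_sub_dotProduct_le (isCompact_closedBall wbar r) hrW hwbar
  refine ⟨r + |η - H wbar| / (c * r), fun w hw hHw => ?_⟩
  by_contra! hcon
  set d := ‖w - wbar‖
  have hd : r < d := lt_of_le_of_lt (by have := abs_nonneg (η - H wbar); simp; positivity) hcon
  have hd0 : 0 < d := hr.trans hd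
  set s := r / d
  set z := wbar + s • (w - wbar)
  have hzs : z - wbar = s • (w - wbar) := by simp [z]
  have hs0 : 0 < s := div_pos hr hd0
  have hs1 : s < 1 := (div_lt_one hd0).2 hd
  have hnorm : ‖z - wbar‖ = r := by
    rw [hzs, norm_smul, Real.norm_of_nonneg hs0.le]
    exact div_mul_cancel₀ _ hd0.ne'
  have hz : z ∈ Metric.closedBall wbar r := by
    rw [Metric.mem_closedBall, dist_eq_norm, hnorm]
  have h1 := hle z hz
  have h2 := h.potential_gradient_le hH hwbar (hrW hz)
  have h3 := h.potential_gradient_le hH (hrW hz) hw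
  rw [hκ, sub_self, zero_dotProduct] at h2
  have h4 : c * r ^ 2 ≤ (κ - k z) ⬝ᵥ (z - wbar) := by
    have e : (κ - k z) ⬝ᵥ (z - wbar) = -((k z - k wbar) ⬝ᵥ (z - wbar)) := by
      rw [← neg_dotProduct, neg_sub, hκ]
    have h5 := norm_sq_le_dotProduct (z - wbar)
    rw [hnorm] at h5
    have := mul_le_mul_of_nonneg_left h5 hc.le
    rw [e]
    linarith
  have e : w - z = ((1 - s) / s) • (z - wbar) := by
    rw [hzs, smul_smul, div_mul_cancel₀ _ hs0.ne']
    simp only [z]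
    module
  rw [e, dotProduct_smul, smul_eq_mul] at h3
  have h5 : (1 - s) / s = d / r - 1 := by
    simp only [s]
    field_simp
  have h6 : 0 ≤ d / r - 1 := by
    rw [sub_nonneg, one_le_div hr]; exact hd.le
  rw [h5] at h3
  have h7 := mul_le_mul_of_nonneg_left h4 h6
  have h8 : (d / r - 1) * (c * r ^ 2) = (d - r) * (c * r) := by
    field_simp
  have h9 : |η - H wbar| < (d - r) * (c * r) := by
    rw [← div_lt_iff₀ (by positivity)]
    linarith
  have := le_abs_self (η - H wbar)
  linarith

end IsCurvatureMap

end

/-! ### The Calabi flow of a curvature map. -/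

section

variable {ι : Type*} [Fintype ι]

/-- Cauchy–Schwarz turns definiteness into expansion. It serves twice: for the decay of the energy
and to bound the distance to `wbar` by the energy. -/
theorem mul_dotProduct_self_le {u v : ι → ℝ} {c : ℝ} (hc : 0 < c) (h : u ⬝ᵥ v ≤ -(c * (v ⬝ᵥ v))) :
    c ^ 2 * (v ⬝ᵥ v) ≤ u ⬝ᵥ u := by
  have h1 := dotProduct_sq_le u v
  have h3 := dotProduct_self_nonneg' u
  rcases (dotProduct_self_nonneg' v).eq_or_lt with h0 | h0
  · rwa [← h0, mul_zero]
  · refine le_of_mul_le_mul_right ?_ h0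
    have h2 : (c * (v ⬝ᵥ v)) ^ 2 ≤ (u ⬝ᵥ v) ^ 2 := by
      rw [← neg_sq (u ⬝ᵥ v)]
      exact pow_le_pow_left₀ (by positivity) (by linarith) 2
    calc c ^ 2 * (v ⬝ᵥ v) * (v ⬝ᵥ v) = (c * (v ⬝ᵥ v)) ^ 2 := by ring
      _ ≤ _ := h2.trans h1

/-- The vector field of the Calabi flow with target `κ`. -/
noncomputable def calabiField (k : (ι → ℝ) → ι → ℝ) (κ w : ι → ℝ) : ι → ℝ :=
  fderiv ℝ k w (κ - k w)

/-- The Calabi energy, up to a factor. -/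
def calabiEnergy (k : (ι → ℝ) → ι → ℝ) (κ w : ι → ℝ) : ℝ := (κ - k w) ⬝ᵥ (κ - k w)

namespace IsCurvatureMap

variable {W : Set (ι → ℝ)} {k : (ι → ℝ) → ι → ℝ} {κ : ι → ℝ}

theorem contDiffAt_calabiField (h : IsCurvatureMap W k) {w : ι → ℝ} (hw : w ∈ W) :
    ContDiffAt ℝ 1 (calabiField k κ) w :=
  (h.contDiffAt_fderiv hw).clm_apply
    (contDiffAt_const.sub ((h.contDiffAt w hw).of_le one_le_two))

/-- By symmetry of the Jacobian the Calabi field is minus half the gradient of the energy. -/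
theorem hasDerivWithinAt_calabiEnergy (h : IsCurvatureMap W k) {v : ℝ → ι → ℝ} {z : ι → ℝ}
    {D : Set ℝ} {t : ℝ} (hv : HasDerivWithinAt v z D t) (hW : v t ∈ W) :
    HasDerivWithinAt (fun s => calabiEnergy k κ (v s)) (-2 * (calabiField k κ (v t) ⬝ᵥ z)) D t := by
  have hy : HasDerivWithinAt (fun s => κ - k (v s)) (-(fderiv ℝ k (v t) z)) D t :=
    ((h.hasFDerivAt hW).comp_hasDerivWithinAt t hv).const_sub κ
  have h1 := ((dotL ι).hasFDerivAt.comp_hasDerivWithinAt t hy).clm_apply hy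
  simp only [Function.comp_apply, dotL_apply] at h1
  refine h1.congr_deriv ?_
  rw [calabiField, dotProduct_neg, neg_dotProduct, dotProduct_comm (κ - k (v t)),
    h.symm _ hW z]
  ring

theorem hasDerivWithinAt_potential {H : (ι → ℝ) → ℝ}
    (hH : ∀ w ∈ W, HasFDerivAt H (dotL ι (κ - k w)) w) {v : ℝ → ι → ℝ} {z : ι → ℝ}
    {D : Set ℝ} {t : ℝ} (hv : HasDerivWithinAt v z D t) (hW : v t ∈ W) :
    HasDerivWithinAt (fun s => H (v s)) ((κ - k (v t)) ⬝ᵥ z) D t := by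
  rw [← dotL_apply]
  exact (hH _ hW).comp_hasDerivWithinAt t hv

theorem calabiField_dotProduct_nonpos (h : IsCurvatureMap W k) {w : ι → ℝ} (hw : w ∈ W) :
    (κ - k w) ⬝ᵥ calabiField k κ w ≤ 0 := by
  rw [dotProduct_comm, calabiField]
  by_cases h0 : κ - k w = 0
  · rw [h0, dotProduct_zero]
  · exact (h.neg w hw _ h0).le

/-- The potential and the energy do not increase along a rescaled Calabi flow. -/
theorem le_of_hasDerivWithinAt (h : IsCurvatureMap W k) {H : (ι → ℝ) → ℝ}
    (hH : ∀ w ∈ W, HasFDerivAt H (dotL ι (κ - k w)) w) {v : ℝ → ι → ℝ} {χ : (ι → ℝ) → ℝ}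
    (hχ : ∀ w, 0 ≤ χ w) {D : Set ℝ} (hD : Convex ℝ D) (hW : ∀ t ∈ D, v t ∈ W)
    (hv : ∀ t ∈ D, HasDerivWithinAt v (χ (v t) • calabiField k κ (v t)) D t) {s t : ℝ}
    (hs : s ∈ D) (ht : t ∈ D) (hst : s ≤ t) :
    H (v t) ≤ H (v s) ∧ calabiEnergy k κ (v t) ≤ calabiEnergy k κ (v s) := by
  constructor
  · refine antitoneOn_of_hasDerivWithinAt_nonpos (f := fun s => H (v s)) hD
      (fun t ht => (hasDerivWithinAt_potential hH (hv t ht) (hW t ht)).continuousWithinAt)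
      (fun t ht => (hasDerivWithinAt_potential hH (hv t (interior_subset ht))
        (hW t (interior_subset ht))).mono interior_subset) (fun t ht => ?_) hs ht hst
    rw [dotProduct_smul, smul_eq_mul]
    exact mul_nonpos_of_nonneg_of_nonpos (hχ _)
      (h.calabiField_dotProduct_nonpos (hW t (interior_subset ht)))
  · refine antitoneOn_of_hasDerivWithinAt_nonpos (f := fun s => calabiEnergy k κ (v s)) hD
      (fun t ht => (h.hasDerivWithinAt_calabiEnergy (hv t ht) (hW t ht)).continuousWithinAt)
      (fun t ht => (h.hasDerivWithinAt_calabiEnergy (hv t (interior_subset ht))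
        (hW t (interior_subset ht))).mono interior_subset) (fun t ht => ?_) hs ht hst
    rw [dotProduct_smul, smul_eq_mul]
    have := mul_nonneg (hχ (v t)) (dotProduct_self_nonneg' (calabiField k κ (v t)))
    linarith

/-- The energy bounds k above and the potential bounds w. No lower bound on k is needed, so of the
two properness conditions only `exists_isCompact` enters. -/
theorem exists_isCompact_sublevel (h : IsCurvatureMap W k) {wbar : ι → ℝ}
    (hwbar : wbar ∈ W) (hκ : k wbar = κ) {H : (ι → ℝ) → ℝ}
    (hH : ∀ w ∈ W, HasFDerivAt H (dotL ι (κ - k w)) w) (η e : ℝ) :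
    ∃ Q ⊆ W, IsCompact Q ∧ ∀ w ∈ W, H w ≤ η → calabiEnergy k κ w ≤ e → w ∈ Q := by
  obtain ⟨R, hR⟩ := h.exists_norm_sub_le_of_potential_le hwbar hκ hH η
  obtain ⟨Q, hQW, hQ, hQ'⟩ := h.exists_isCompact (‖κ‖ + √e) (‖wbar‖ + R)
  refine ⟨Q, hQW, hQ, fun w hw h1 h2 => hQ' w hw (fun i => ?_) fun i => ?_⟩
  · have h3 : ‖κ - k w‖ ≤ √e :=
      Real.le_sqrt_of_sq_le ((norm_sq_le_dotProduct _).trans h2)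
    have h4 := (norm_le_pi_norm (κ - k w) i).trans h3
    have h5 := norm_le_pi_norm κ i
    rw [Real.norm_eq_abs] at h4 h5
    have h6 := neg_abs_le ((κ - k w) i)
    have h7 := le_abs_self (κ i)
    rw [Pi.sub_apply] at h4 h6
    linarith
  · have h4 := (norm_le_pi_norm (w - wbar) i).trans (hR w hw h1)
    have h5 := norm_le_pi_norm wbar i
    rw [Real.norm_eq_abs] at h4 h5
    have h6 := le_abs_self ((w - wbar) i)
    have h7 := le_abs_self (wbar i)
    rw [Pi.sub_apply] at h4 h6
    linarith

theorem abs_sub_le_of_hasDerivWithinAt (h : IsCurvatureMap W k) {wbar : ι → ℝ}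
    (hwbar : wbar ∈ W) (hκ : k wbar = κ) {Q : Set (ι → ℝ)} (hQ : IsCompact Q) (hQW : Q ⊆ W)
    {v : ℝ → ι → ℝ} (hvQ : ∀ t ∈ Set.Ici (0 : ℝ), v t ∈ Q)
    (hv : ∀ t ∈ Set.Ici (0 : ℝ), HasDerivWithinAt v (calabiField k κ (v t)) (Set.Ici 0) t) :
    ∃ C c : ℝ, 0 < C ∧ 0 < c ∧ ∀ t : ℝ, 0 ≤ t → ∀ i, |v t i - wbar i| ≤ C * Real.exp (-c * t) := by
  obtain ⟨a, ha, hle⟩ := h.exists_fderiv_dotProduct_le hQ hQW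
  obtain ⟨b, hb, hle'⟩ := h.exists_sub_dotProduct_le hQ hQW hwbar
  -- Along the flow E' = -2|Dk(κ - k)|² ≤ -2a²E. Taking square roots below leaves the rate a².
  have hdecay : ∀ t ∈ Set.Ici (0 : ℝ), Real.exp (2 * a ^ 2 * t) * calabiEnergy k κ (v t) ≤
      calabiEnergy k κ (v 0) := by
    have hd : ∀ t ∈ Set.Ici (0 : ℝ),
        HasDerivWithinAt (fun t => Real.exp (2 * a ^ 2 * t) * calabiEnergy k κ (v t))
          (Real.exp (2 * a ^ 2 * t) * (2 * a ^ 2) * calabiEnergy k κ (v t) +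
            Real.exp (2 * a ^ 2 * t) * (-2 * (calabiField k κ (v t) ⬝ᵥ calabiField k κ (v t))))
          (Set.Ici 0) t := fun t ht => by
      have h1 : HasDerivWithinAt (fun t : ℝ => 2 * a ^ 2 * t) (2 * a ^ 2) (Set.Ici 0) t := by
        simpa using (hasDerivWithinAt_id t (Set.Ici 0)).const_mul (2 * a ^ 2)
      exact h1.exp.mul (h.hasDerivWithinAt_calabiEnergy (hv t ht) (hQW (hvQ t ht)))
    intro t ht
    have := antitoneOn_of_hasDerivWithinAt_nonpos (convex_Ici (0 : ℝ))
      (fun t ht => (hd t ht).continuousWithinAt)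
      (fun t ht => (hd t (interior_subset ht)).mono interior_subset) (fun t ht => ?_)
      Set.self_mem_Ici ht ht
    · simpa using this
    · have h2 := mul_dotProduct_self_le ha (hle (v t) (hvQ t (interior_subset ht)) (κ - k (v t)))
      have h3 := mul_le_mul_of_nonneg_left h2 (Real.exp_pos (2 * a ^ 2 * t)).le
      simp only [calabiEnergy, calabiField]
      linarith
  refine ⟨√(calabiEnergy k κ (v 0)) / b + 1, a ^ 2, by positivity, by positivity,
    fun t ht i => ?_⟩
  have h1 := mul_dotProduct_self_le hb (hle' (v t) (hvQ t ht))
  have h2 : (k (v t) - k wbar) ⬝ᵥ (k (v t) - k wbar) = calabiEnergy k κ (v t) := by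
    rw [calabiEnergy, ← hκ, ← neg_sub, dotProduct_neg, neg_dotProduct, neg_neg]
  have h3 := hdecay t ht
  have h4 : calabiEnergy k κ (v t) ≤ calabiEnergy k κ (v 0) * Real.exp (-a ^ 2 * t) ^ 2 := by
    rw [← Real.exp_nat_mul, show ((2 : ℕ) : ℝ) * (-a ^ 2 * t) = -(2 * a ^ 2 * t) by push_cast; ring,
      Real.exp_neg, ← div_eq_mul_inv, le_div_iff₀ (Real.exp_pos _), mul_comm]
    exact h3
  rw [h2] at h1
  have hE := dotProduct_self_nonneg' (κ - k (v 0))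
  change 0 ≤ calabiEnergy k κ (v 0) at hE
  have h5 : b * ‖v t - wbar‖ ≤ √(calabiEnergy k κ (v 0)) * Real.exp (-a ^ 2 * t) := by
    refine le_of_sq_le_sq ?_ (by positivity)
    rw [mul_pow, mul_pow, Real.sq_sqrt hE]
    exact (mul_le_mul_of_nonneg_left (norm_sq_le_dotProduct _) (sq_nonneg b)).trans (h1.trans h4)
  have h6 := norm_le_pi_norm (v t - wbar) i
  rw [Real.norm_eq_abs, Pi.sub_apply] at h6
  have h7 : ‖v t - wbar‖ ≤ √(calabiEnergy k κ (v 0)) / b * Real.exp (-a ^ 2 * t) := by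
    rw [div_mul_eq_mul_div, le_div_iff₀ hb, mul_comm]
    exact h5
  have h8 := Real.exp_pos (-a ^ 2 * t)
  linarith

/-- Long time existence, uniqueness and exponential convergence of the Calabi flow. -/
theorem exists_calabiFlow (h : IsCurvatureMap W k) (hκ : ∀ i, 0 < κ i) :
    ∃ wbar ∈ W, k wbar = κ ∧ (∀ w ∈ W, k w = κ → w = wbar) ∧
      ∀ w₀ ∈ W, ∃ w : ℝ → ι → ℝ,
        (w 0 = w₀ ∧ ∀ t ∈ Set.Ici (0 : ℝ), w t ∈ W ∧
          HasDerivWithinAt w (calabiField k κ (w t)) (Set.Ici 0) t) ∧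
        (∀ (b : ℝ) (v : ℝ → ι → ℝ), (v 0 = w₀ ∧ ∀ t ∈ Set.Ico 0 b, v t ∈ W ∧
          HasDerivWithinAt v (calabiField k κ (v t)) (Set.Ico 0 b) t) →
          ∀ t ∈ Set.Ico 0 b, v t = w t) ∧
        ∃ C c : ℝ, 0 < C ∧ 0 < c ∧ ∀ t : ℝ, 0 ≤ t → ∀ i,
          |w t i - wbar i| ≤ C * Real.exp (-c * t) := by
  obtain ⟨wbar, hwbar, hk⟩ : κ ∈ k '' W := by rw [h.image_eq]; exact hκ
  refine ⟨wbar, hwbar, hk, fun w hw hwk => h.injOn hw hwbar (hwk.trans hk.symm),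
    fun w₀ hw₀ => ?_⟩
  obtain ⟨H, hH⟩ := h.exists_potential κ
  obtain ⟨Q, hQW, hQ, hQ'⟩ := h.exists_isCompact_sublevel hwbar hk hH (H w₀)
    (calabiEnergy k κ w₀)
  have hw₀Q : w₀ ∈ Q := hQ' w₀ hw₀ le_rfl le_rfl
  -- The field is C¹ only on W. Multiplied by a cutoff equal to 1 on Q it becomes globally Lipschitz
  -- and bounded, so its flow exists for all time.
  obtain ⟨χ, hχ, hχc, hχW, hχ1, hχ0⟩ := exists_contDiff_cutoff hQ h.isOpen hQW
  set X : (ι → ℝ) → ι → ℝ := fun w => χ w • calabiField k κ w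
  have hX : ContDiff ℝ 1 X := contDiff_smul_of_tsupport_subset hχ hχW fun w hw =>
    h.contDiffAt_calabiField hw
  have hXQ : ∀ w ∈ Q, X w = calabiField k κ w := fun w hw => by
    simp only [X, hχ1 w hw, one_smul]
  have hXc : HasCompactSupport X := hχc.smul_right
  obtain ⟨C, hC⟩ := ContDiff.lipschitzWith_of_hasCompactSupport hXc hX one_ne_zero
  obtain ⟨L, hL⟩ := hXc.exists_bound_of_continuous hX.continuous
  obtain ⟨w, hw0, hw⟩ := exists_hasDerivWithinAt_Ici_of_lipschitzWith hC hL w₀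
  -- The cut-off flow either rests at `w₀` or never meets a zero of `X`. In the second case it stays
  -- in the support of χ, hence in W, where the monotone quantities are available.
  have hwW : ∀ t ∈ Set.Ici (0 : ℝ), w t ∈ W := by
    intro t ht
    by_cases h0 : X w₀ = 0
    · have hEq : Set.EqOn w (fun _ => w₀) (Set.Icc 0 t) :=
        ODE_solution_unique (v := fun _ => X) (fun _ => hC)
          (fun s hs => (hw s hs.1).continuousWithinAt.mono Set.Icc_subset_Ici_self)
          (fun s hs => (hw s hs.1).mono (Set.Ici_subset_Ici.2 hs.1)) continuousOn_const
          (fun s _ => by simpa only [h0] using hasDerivWithinAt_const s _ w₀) hw0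
      rw [hEq ⟨ht, le_rfl⟩]
      exact hw₀
    · have hne := ne_zero_of_hasDerivWithinAt_Ici hC hw (by rwa [hw0]) ht
      refine hχW (subset_tsupport χ fun h1 => hne ?_)
      simp only [X, h1, zero_smul]
  have hwQ : ∀ t ∈ Set.Ici (0 : ℝ), w t ∈ Q := by
    intro t ht
    have := h.le_of_hasDerivWithinAt hH hχ0 (convex_Ici 0) hwW hw Set.self_mem_Ici ht ht
    rw [hw0] at this
    exact hQ' _ (hwW t ht) this.1 this.2
  have hw' : ∀ t ∈ Set.Ici (0 : ℝ), HasDerivWithinAt w (calabiField k κ (w t)) (Set.Ici 0) t :=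
    fun t ht => by rw [← hXQ _ (hwQ t ht)]; exact hw t ht
  refine ⟨w, ⟨hw0, fun t ht => ⟨hwW t ht, hw' t ht⟩⟩, fun b v ⟨hv0, hv⟩ t ht => ?_,
    h.abs_sub_le_of_hasDerivWithinAt hwbar hk hQ hQW hwQ hw'⟩
  -- The same monotonicity with χ = 1 traps every competing solution in Q. There it solves the
  -- cut-off equation as well, for which uniqueness is known.
  have hvQ : ∀ s ∈ Set.Ico 0 b, v s ∈ Q := by
    intro s hs
    have := h.le_of_hasDerivWithinAt hH (χ := fun _ => 1) (fun _ => zero_le_one) (convex_Ico 0 b)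
      (fun s hs => (hv s hs).1) (fun s hs => by simpa only [one_smul] using (hv s hs).2)
      ⟨le_rfl, hs.1.trans_lt hs.2⟩ hs hs.1
    rw [hv0] at this
    exact hQ' _ (hv s hs).1 this.1 this.2
  have hsub : Set.Icc 0 t ⊆ Set.Ico 0 b := fun s hs => ⟨hs.1, hs.2.trans_lt ht.2⟩
  refine ODE_solution_unique (v := fun _ => X) (fun _ => hC)
    (fun s hs => (hv s (hsub hs)).2.continuousWithinAt.mono hsub)
    (fun s hs => ?_)
    (fun s hs => (hw s hs.1).continuousWithinAt.mono Set.Icc_subset_Ici_self)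
    (fun s hs => (hw s hs.1).mono (Set.Ici_subset_Ici.2 hs.1)) (hv0.trans hw0.symm)
    ⟨ht.1, le_rfl⟩
  have hs' := hsub (Set.Ico_subset_Icc_self hs)
  rw [hXQ _ (hvQ s hs')]
  exact (((hv s hs').2.mono hsub).Ici_of_Icc hs.1 hs.2)

end IsCurvatureMap

end

/-! ### Application to triangulated surfaces. -/

theorem IsCurvatureMap.congr {ι : Type*} [Fintype ι] {W : Set (ι → ℝ)}
    {k k' : (ι → ℝ) → ι → ℝ} (h : IsCurvatureMap W k) (hk : Set.EqOn k' k W) :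
    IsCurvatureMap W k' := by
  have he : ∀ w ∈ W, k' =ᶠ[nhds w] k := fun w hw => hk.eventuallyEq_of_mem (h.isOpen.mem_nhds hw)
  have hf : ∀ w ∈ W, fderiv ℝ k' w = fderiv ℝ k w := fun w hw => (he w hw).fderiv_eq
  refine ⟨h.isOpen, h.convex, h.nonempty, fun w hw =>
    (h.contDiffAt w hw).congr_of_eventuallyEq (he w hw), fun w hw => ?_, fun w hw => ?_,
    fun w hw => ?_, fun M R => ?_, fun m hm M => ?_⟩
  · rw [hf w hw]; exact h.symm w hw
  · rw [hf w hw]; exact h.neg w hw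
  · rw [hk hw]; exact h.pos w hw
  · obtain ⟨Q, hQW, hQ, hQ'⟩ := h.exists_isCompact M R
    exact ⟨Q, hQW, hQ, fun w hw h1 => hQ' w hw (by rwa [hk hw] at h1)⟩
  · obtain ⟨R, hR⟩ := h.exists_le m hm M
    exact ⟨R, fun w hw h1 => by rw [hk hw] at h1 ⊢; exact hR w hw h1⟩

theorem HexagonGluing.isCurvatureMap_boundaryLength {F β : Type*} [Fintype F] [Fintype β]
    [DecidableEq β] {p : F × Fin 3 → β} (hp : Function.Surjective p) {x : F × Fin 3 → ℝ}
    (hx : (domain p x).Nonempty) : IsCurvatureMap (domain p x) (boundaryLength p x) where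
  isOpen := isOpen_domain
  convex := convex_domain
  nonempty := hx
  contDiffAt _ hw := contDiffAt_boundaryLength hw
  symm _ hw := fderiv_boundaryLength_symm hw
  neg _ hw _ hv := fderiv_boundaryLength_neg hp hw hv
  pos _ hw := boundaryLength_pos hp hw
  exists_isCompact := exists_isCompact_of_boundaryLength_le hp x
  exists_le _ hm := exists_le_of_le_boundaryLength hp x hm

namespace IdealTriangulation

variable {F : Type*} (T : IdealTriangulation F) (l' : T.Edge → ℝ)

/-- The logarithm of the hyperbolic cosine of half the length of a red side. -/
noncomputable def logCoshHalf (r : F × Fin 3) : ℝ := Real.log (Real.cosh (l' (T.edge r) / 2))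

theorem comp_surjective : Function.Surjective T.comp := Quot.mk_surjective

theorem exp_endSum_mul_cosh (w : T.Bdry → ℝ) (r : F × Fin 3) :
    Real.exp (T.endSum w (T.edge r)) * Real.cosh (l' (T.edge r) / 2) =
      Real.exp (HexagonGluing.logCosh T.comp (T.logCoshHalf l') w r) := by
  rw [HexagonGluing.logCosh, Real.exp_add, logCoshHalf, Real.exp_log (Real.cosh_pos _)]
  rfl

theorem admissible_eq_domain :
    T.admissible l' = HexagonGluing.domain T.comp (T.logCoshHalf l') := by
  ext w
  constructor
  · rintro ⟨l, hl, hs⟩ r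
    have h := hs (T.edge r)
    rw [exp_endSum_mul_cosh] at h
    rw [← Real.one_lt_exp_iff, ← h]
    exact Real.one_lt_cosh.2 (half_pos (hl _)).ne'
  · intro hw
    have h1 : ∀ e, 1 < Real.exp (T.endSum w e) * Real.cosh (l' e / 2) := by
      rintro ⟨r⟩
      exact (T.exp_endSum_mul_cosh l' w r).symm ▸ Real.one_lt_exp_iff.2 (hw r)
    refine ⟨T.scaled l' w, fun e => mul_pos two_pos (Real.arcosh_pos (h1 e)), fun e => ?_⟩
    rw [scaled, mul_div_cancel_left₀ _ two_ne_zero, Real.cosh_arcosh (h1 e).le]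

variable {T l'}

theorem scaled_pos {w : T.Bdry → ℝ} (hw : w ∈ T.admissible l') (r : F × Fin 3) :
    0 < T.scaled l' w (T.edge r) := by
  rw [admissible_eq_domain] at hw
  refine mul_pos two_pos (Real.arcosh_pos ?_)
  rw [exp_endSum_mul_cosh]
  exact Real.one_lt_exp_iff.2 (hw r)

/-- The identity cosh l = 2 cosh²(l/2) - 1, with cosh(l/2) the exponential of `logCosh`. -/
theorem cosh_scaled {w : T.Bdry → ℝ} (hw : w ∈ T.admissible l') (r : F × Fin 3) :
    Real.cosh (T.scaled l' w (T.edge r)) =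
      HexagonGluing.redCosh T.comp (T.logCoshHalf l') w r := by
  rw [admissible_eq_domain] at hw
  rw [scaled, exp_endSum_mul_cosh, Real.cosh_two_mul, Real.sinh_sq,
    Real.cosh_arcosh (Real.one_le_exp (hw r).le), HexagonGluing.redCosh,
    show 2 * HexagonGluing.logCosh T.comp (T.logCoshHalf l') w r =
      ((2 : ℕ) : ℝ) * HexagonGluing.logCosh T.comp (T.logCoshHalf l') w r by norm_num,
    Real.exp_nat_mul]
  ring

theorem K_eqOn_boundaryLength [Fintype F] : Set.EqOn (T.K l')
    (HexagonGluing.boundaryLength T.comp (T.logCoshHalf l')) (T.admissible l') := by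
  intro w hw
  funext i
  refine Finset.sum_congr rfl fun c _ => ?_
  rw [arcLength, blackLength_eq (scaled_pos hw _) (scaled_pos hw _) (scaled_pos hw _),
    cosh_scaled hw, cosh_scaled hw, cosh_scaled hw, HexagonGluing.arc]

theorem isCurvatureMap_K [Fintype F] (hl' : T.IsDiscreteMetric l') :
    IsCurvatureMap (T.admissible l') (T.K l') := by
  refine IsCurvatureMap.congr ?_ K_eqOn_boundaryLength
  rw [admissible_eq_domain]
  refine HexagonGluing.isCurvatureMap_boundaryLength T.comp_surjective ⟨0, fun r => ?_⟩
  have := Real.log_pos (Real.one_lt_cosh.2 (half_pos (hl' (T.edge r))).ne')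
  simpa [HexagonGluing.logCosh, logCoshHalf] using this

theorem laplacian_mulVec [Fintype F] (w u : T.Bdry → ℝ) :
    T.laplacian l' w *ᵥ u = fderiv ℝ (T.K l') w u := by
  funext i
  conv_rhs => rw [pi_eq_sum_univ' u, map_sum]
  simp [Matrix.mulVec, dotProduct, laplacian, mul_comm]

theorem isCalabiFlow_iff [Fintype F] {Kbar w₀ : T.Bdry → ℝ} {I : Set ℝ} {w : ℝ → T.Bdry → ℝ} :
    T.IsCalabiFlow l' Kbar w₀ I w ↔ w 0 = w₀ ∧ ∀ t ∈ I, w t ∈ T.admissible l' ∧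
      HasDerivWithinAt w (calabiField (T.K l') Kbar (w t)) I t := by
  simp only [IsCalabiFlow, laplacian_mulVec, calabiField, hasDerivWithinAt_pi]

end IdealTriangulation

theorem mainTheorem1 {F : Type*} [Fintype F] (T : IdealTriangulation F)
    (l' : T.Edge → ℝ) (hl' : T.IsDiscreteMetric l')
    (Kbar : T.Bdry → ℝ) (hKbar : ∀ i, 0 < Kbar i) :
    -- the Laplace operator, i.e. the Jacobian of `K`, exists on the admissible space
    (∀ w ∈ T.admissible l', DifferentiableAt ℝ (T.K l') w) ∧
    ∃ wbar ∈ T.admissible l', T.K l' wbar = Kbar ∧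
      (∀ w ∈ T.admissible l', T.K l' w = Kbar → w = wbar) ∧
      ∀ w₀ ∈ T.admissible l', ∃ w : ℝ → T.Bdry → ℝ,
        -- `w` is a solution for all time
        T.IsCalabiFlow l' Kbar w₀ (Set.Ici 0) w ∧
        -- it is the solution: every solution on some interval `[0, b)` is a restriction of it
        (∀ (b : ℝ) (v : ℝ → T.Bdry → ℝ), T.IsCalabiFlow l' Kbar w₀ (Set.Ico 0 b) v →
          ∀ t ∈ Set.Ico 0 b, v t = w t) ∧
        -- it converges exponentially fast
        ∃ C c : ℝ, 0 < C ∧ 0 < c ∧ ∀ t : ℝ, 0 ≤ t → ∀ i,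
          |w t i - wbar i| ≤ C * Real.exp (-c * t) := by
  have h := IdealTriangulation.isCurvatureMap_K hl'
  simp only [IdealTriangulation.isCalabiFlow_iff]
  exact ⟨fun w hw => (h.hasFDerivAt hw).differentiableAt, h.exists_calabiFlow hKbar⟩
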